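/- Let $d\ge 1$. A rectangle in $\mathbf R^d$ is a product $\prod_{i=1}^d[a_i,b_i)$ with $a_i<b_i$, a cube of side $\varepsilon$ is a rectangle with $b_i-a_i=\varepsilon$ for all $i$, and a multirectangle is a finite union of rectangles. For a multirectangle $M\subset\mathbf R^d$, let $\operatorname{Rec}_d(M)$ be the group of all permutations $f$ of $M$ for which there is a finite partition of $M$ into rectangles such that $f$ is a translation on each of them, and let $D(\operatorname{Rec}_d(M))$ be its derived subgroup. For disjoint rectangles $P,Q\subset M$ that are translates of each other, the rectangle transposition $\tau_{P,Q}\in\operatorname{Rec}_d(M)$ exchanges $P$ and $Q$ by translation and is the identity elsewhere. Theorem. Let $M$ be a nonempty multirectangle in $\mathbf R^d$ (for instance $M=[0,1)^d$). Then: 1. $D(\operatorname{Rec}_d(M))$ is generated by the set of all rectangle transpositions $\tau_{P,Q}$ with $P,Q\subset M$. 2. For all sufficiently small $\varepsilon>0$, $D(\operatorname{Rec}_d(M))$ is generated by the rectangle transpositions $\tau_{P,Q}$ such that each of $P$ and $Q$ is contained in a cube of side $\varepsilon$ contained in $M$. 3. For every nonempty multirectangle $U\subset M$, the rectangle transpositions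 $\tau_{P,Q}$ with $P,Q\subset U$ lie in $D(\operatorname{Rec}_d(M))$, and $D(\operatorname{Rec}_d(M))$ is the only normal subgroup of $D(\operatorname{Rec}_d(M))$ containing all of them. 4. Every nontrivial subgroup of $\operatorname{Rec}_d(M)$ normalized by $D(\operatorname{Rec}_d(M))$ contains $D(\operatorname{Rec}_d(M))$. 5. $D(\operatorname{Rec}_d(M))$ is a simple group. 6. $D(\operatorname{Rec}_d(M))$ is contained in every nontrivial normal subgroup of $\operatorname{Rec}_d(M)$. -/

import Mathlib

namespace RectExchange

/-- A (left-closed, right-open, nonempty) rectangle of `ℝ^d`: a product of intervals `[a_i, b_i)`. -/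
def IsRectangle {d : ℕ} (K : Set (Fin d → ℝ)) : Prop :=
  ∃ a b : Fin d → ℝ, (∀ i, a i < b i) ∧ K = Set.pi Set.univ fun i => Set.Ico (a i) (b i)

/-- The half-open cube with lower corner `c` and side length `ε`. -/
def cube {d : ℕ} (c : Fin d → ℝ) (ε : ℝ) : Set (Fin d → ℝ) :=
  Set.pi Set.univ fun i => Set.Ico (c i) (c i + ε)

/-- A multirectangle is a finite union of rectangles (not necessarily disjoint, possibly none). -/
def IsMultirectangle {d : ℕ} (M : Set (Fin d → ℝ)) : Prop :=
  ∃ P : Set (Set (Fin d → ℝ)), P.Finite ∧ (∀ K ∈ P, IsRectangle K) ∧ ⋃₀ P = M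

/-- `P` is a finite partition of `M` into rectangles. -/
def IsRectPartition {d : ℕ} (P : Set (Set (Fin d → ℝ))) (M : Set (Fin d → ℝ)) : Prop :=
  P.Finite ∧ (∀ K ∈ P, IsRectangle K) ∧ P.PairwiseDisjoint id ∧ ⋃₀ P = M

/-- The permutation `f` of `M` is a rectangle exchange: there is a finite partition of `M` into
rectangles on each of which `f` is a translation. -/
def IsRectExchange {d : ℕ} (M : Set (Fin d → ℝ)) (f : Equiv.Perm M) : Prop :=
  ∃ P : Set (Set (Fin d → ℝ)), IsRectPartition P M ∧
    ∀ K ∈ P, ∃ v : Fin d → ℝ, ∀ x : M, (x : Fin d → ℝ) ∈ K → (f x : Fin d → ℝ) = x + v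

theorem mem_box {d : ℕ} {a b x : Fin d → ℝ} :
    x ∈ Set.pi Set.univ (fun i => Set.Ico (a i) (b i)) ↔ ∀ i, a i ≤ x i ∧ x i < b i := by
  simp [Set.mem_pi]

theorem box_rect_or_empty {d : ℕ} (a b : Fin d → ℝ) :
    IsRectangle (Set.pi Set.univ fun i => Set.Ico (a i) (b i)) ∨
      (Set.pi Set.univ fun i => Set.Ico (a i) (b i)) = ∅ := by
  by_cases h : ∀ i, a i < b i
  · exact Or.inl ⟨a, b, h, rfl⟩
  · right
    push Not at h
    obtain ⟨i, hi⟩ := h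
    ext x
    simp only [mem_box, Set.mem_empty_iff_false, iff_false]
    intro hx
    linarith [(hx i).1, (hx i).2]

theorem inter_rect_or_empty {d : ℕ} {K L : Set (Fin d → ℝ)} (hK : IsRectangle K)
    (hL : IsRectangle L) : IsRectangle (K ∩ L) ∨ K ∩ L = ∅ := by
  obtain ⟨a, b, -, rfl⟩ := hK
  obtain ⟨a', b', -, rfl⟩ := hL
  have : (Set.pi Set.univ fun i => Set.Ico (a i) (b i)) ∩
      (Set.pi Set.univ fun i => Set.Ico (a' i) (b' i)) =
      Set.pi Set.univ fun i => Set.Ico (max (a i) (a' i)) (min (b i) (b' i)) := by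
    ext x
    simp only [Set.mem_inter_iff, mem_box, max_le_iff, lt_min_iff]
    grind
  rw [this]
  exact box_rect_or_empty _ _

theorem translate_rect {d : ℕ} {K : Set (Fin d → ℝ)} (hK : IsRectangle K) (v : Fin d → ℝ) :
    IsRectangle {x | x + v ∈ K} := by
  obtain ⟨a, b, h, rfl⟩ := hK
  refine ⟨a - v, b - v, fun i => by simpa using h i, ?_⟩
  ext x
  simp only [Set.mem_ofPred_eq, mem_box, Pi.add_apply, Pi.sub_apply, sub_le_iff_le_add, lt_sub_iff_add_lt]

/-- A finite disjoint family of rectangles and empty sets gives a partition of its union. -/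
theorem partition_of_family {d : ℕ} {ι : Type*} [Finite ι] (K : ι → Set (Fin d → ℝ))
    (M : Set (Fin d → ℝ)) (hK : ∀ i, IsRectangle (K i) ∨ K i = ∅)
    (hdisj : ∀ i j x, x ∈ K i → x ∈ K j → i = j) (hM : ∀ x, x ∈ M ↔ ∃ i, x ∈ K i) :
    IsRectPartition {L | ∃ i, K i = L ∧ L.Nonempty} M := by
  refine ⟨(Set.finite_range K).subset ?_, ?_, ?_, ?_⟩
  · rintro L ⟨i, rfl, -⟩
    exact ⟨i, rfl⟩
  · rintro L ⟨i, rfl, hne⟩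
    exact (hK i).resolve_right hne.ne_empty
  · rintro L ⟨i, rfl, -⟩ L' ⟨j, rfl, -⟩ hne
    refine Set.disjoint_left.2 fun x hx hx' => hne ?_
    rw [hdisj i j x hx hx']
  · ext x
    simp only [Set.mem_sUnion, Set.mem_ofPred_eq, hM]
    constructor
    · rintro ⟨L, ⟨i, rfl, -⟩, hx⟩
      exact ⟨i, hx⟩
    · rintro ⟨i, hx⟩
      exact ⟨K i, ⟨i, rfl, ⟨x, hx⟩⟩, hx⟩

theorem IsRectPartition.exists_mem {d : ℕ} {P : Set (Set (Fin d → ℝ))} {M : Set (Fin d → ℝ)}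
    (h : IsRectPartition P M) {x : Fin d → ℝ} (hx : x ∈ M) : ∃ K ∈ P, x ∈ K := by
  rw [← h.2.2.2] at hx
  exact hx

theorem IsRectPartition.subset {d : ℕ} {P : Set (Set (Fin d → ℝ))} {M : Set (Fin d → ℝ)}
    (h : IsRectPartition P M) {K : Set (Fin d → ℝ)} (hK : K ∈ P) : K ⊆ M := by
  rw [← h.2.2.2]
  exact Set.subset_sUnion_of_mem hK

theorem IsRectPartition.eq_of_mem {d : ℕ} {P : Set (Set (Fin d → ℝ))} {M : Set (Fin d → ℝ)}
    (h : IsRectPartition P M) {K L : Set (Fin d → ℝ)} (hK : K ∈ P) (hL : L ∈ P)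
    {x : Fin d → ℝ} (hxK : x ∈ K) (hxL : x ∈ L) : K = L := by
  by_contra hne
  exact Set.disjoint_left.1 (h.2.2.1 hK hL hne) hxK hxL

/-- The difference of two rectangles is a finite disjoint union of rectangles. -/
theorem exists_partition_diff {d : ℕ} {K L : Set (Fin d → ℝ)} (hK : IsRectangle K)
    (hL : IsRectangle L) : ∃ P, IsRectPartition P (K \ L) := by
  obtain ⟨a, b, -, rfl⟩ := hK
  obtain ⟨a', b', h', rfl⟩ := hL
  let lo : Fin d × Bool → Fin d → ℝ := fun p j =>
    if j < p.1 then max (a j) (a' j) else if j = p.1 then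
      (if p.2 then max (a j) (b' j) else a j) else a j
  let hi : Fin d × Bool → Fin d → ℝ := fun p j =>
    if j < p.1 then min (b j) (b' j) else if j = p.1 then
      (if p.2 then b j else min (b j) (a' j)) else b j
  have key : ∀ p x, x ∈ Set.pi Set.univ (fun i => Set.Ico (lo p i) (hi p i)) ↔
      (∀ j, a j ≤ x j ∧ x j < b j) ∧ (∀ j, j < p.1 → a' j ≤ x j ∧ x j < b' j) ∧
        (if p.2 then b' p.1 ≤ x p.1 else x p.1 < a' p.1) := by
    rintro ⟨i, s⟩ x
    rw [mem_box]
    constructor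
    · intro h
      refine ⟨fun j => ?_, fun j hj => ?_, ?_⟩
      · have := h j
        simp only [lo, hi] at this
        cases s <;> grind
      · have := h j
        simp only [lo, hi] at this
        grind
      · have := h i
        simp only [lo, hi] at this
        cases s <;> grind
    · rintro ⟨h1, h2, h3⟩ j
      have h1 := h1 j
      have h2 := h2 j
      simp only [lo, hi]
      cases s <;> grind
  refine ⟨_, partition_of_family
    (fun p : Fin d × Bool => Set.pi Set.univ fun i => Set.Ico (lo p i) (hi p i)) _
    (fun p => box_rect_or_empty _ _) ?_ ?_⟩
  · rintro ⟨i, s⟩ ⟨j, t⟩ x hx hy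
    rw [key] at hx hy
    obtain ⟨-, hx2, hx3⟩ := hx
    obtain ⟨-, hy2, hy3⟩ := hy
    dsimp only at hx2 hx3 hy2 hy3
    rcases lt_trichotomy i j with hij | rfl | hij
    · have := hy2 i hij
      cases s <;> grind
    · have := h' i
      cases s <;> cases t <;> grind
    · have := hx2 j hij
      cases t <;> grind
  · intro x
    simp only [key, Set.mem_sdiff, mem_box]
    constructor
    · rintro ⟨h1, h2⟩
      push Not at h2
      have hex : ∃ i : Fin d, ¬ (a' i ≤ x i ∧ x i < b' i) := by
        obtain ⟨i, hi⟩ := h2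
        exact ⟨i, fun h => absurd (hi h.1) (not_le.2 h.2)⟩
      obtain ⟨i, hi, hmin⟩ := WellFounded.has_min (wellFounded_lt (α := Fin d))
        {i | ¬ (a' i ≤ x i ∧ x i < b' i)} hex
      have hlt : ∀ j, j < i → a' j ≤ x j ∧ x j < b' j := fun j hj => by
        by_contra hc
        exact hmin j hc hj
      by_cases hc : a' i ≤ x i
      · refine ⟨(i, true), h1, hlt, ?_⟩
        simp only [Set.mem_ofPred_eq] at hi
        simpa using not_lt.1 fun h => hi ⟨hc, h⟩
      · exact ⟨(i, false), h1, hlt, by simpa using hc⟩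
    · rintro ⟨⟨i, s⟩, h1, -, h3⟩
      refine ⟨h1, fun h => ?_⟩
      have := h i
      cases s <;> grind

/-- A multirectangle admits a finite partition into rectangles. -/
theorem IsMultirectangle.exists_partition {d : ℕ} {M : Set (Fin d → ℝ)}
    (hM : IsMultirectangle M) : ∃ P, IsRectPartition P M := by
  obtain ⟨S, hfin, hrect, rfl⟩ := hM
  induction S, hfin using Set.Finite.induction_on with
  | empty => exact ⟨∅, by simp [IsRectPartition]⟩
  | @insert R S _ _ ih =>
    obtain ⟨P, hP⟩ := ih fun K hK => hrect K (Set.mem_insert_of_mem _ hK)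
    have hR := hrect R (Set.mem_insert _ _)
    have hch : ∀ K : P, ∃ Q, IsRectPartition Q (K.1 \ R) := fun K =>
      exists_partition_diff (hP.2.1 K K.2) hR
    choose Q hQ using hch
    have : Finite P := hP.1
    have : ∀ K : P, Finite (Q K) := fun K => (hQ K).1
    refine ⟨_, partition_of_family
      (fun o : Option (Σ K : P, Q K) => o.elim R fun p => p.2.1) _ ?_ ?_ ?_⟩
    · rintro (_ | ⟨K, L⟩)
      · exact Or.inl hR
      · exact Or.inl ((hQ K).2.1 L L.2)
    · rintro (_ | ⟨K, L⟩) (_ | ⟨K', L'⟩) x hx hx'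
      · rfl
      · exact absurd hx ((hQ K').subset L'.2 hx').2
      · exact absurd hx' ((hQ K).subset L.2 hx).2
      · have h1 := (hQ K).subset L.2 hx
        have h2 := (hQ K').subset L'.2 hx'
        obtain rfl : K = K' := Subtype.ext (hP.eq_of_mem K.2 K'.2 h1.1 h2.1)
        obtain rfl : L = L' := Subtype.ext ((hQ K).eq_of_mem L.2 L'.2 hx hx')
        rfl
    · intro x
      rw [Set.sUnion_insert]
      constructor
      · intro hx
        by_cases hxR : x ∈ R
        · exact ⟨none, hxR⟩
        · obtain ⟨K, hK, hxK⟩ := hP.exists_mem (hx.resolve_left hxR)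
          obtain ⟨L, hL, hxL⟩ := (hQ ⟨K, hK⟩).exists_mem ⟨hxK, hxR⟩
          exact ⟨some ⟨⟨K, hK⟩, ⟨L, hL⟩⟩, hxL⟩
      · rintro ⟨_ | ⟨K, L⟩, hx⟩
        · exact Or.inl hx
        · exact Or.inr (hP.subset K.2 ((hQ K).subset L.2 hx).1)

theorem isRectExchange_one {d : ℕ} {M : Set (Fin d → ℝ)} (hM : IsMultirectangle M) :
    IsRectExchange M 1 := by
  obtain ⟨P, hP⟩ := hM.exists_partition
  exact ⟨P, hP, fun K _ => ⟨0, fun x _ => by simp⟩⟩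

theorem IsRectExchange.mul {d : ℕ} {M : Set (Fin d → ℝ)} {f g : Equiv.Perm M}
    (hf : IsRectExchange M f) (hg : IsRectExchange M g) : IsRectExchange M (f * g) := by
  obtain ⟨P, hP, hPf⟩ := hf
  obtain ⟨Q, hQ, hQg⟩ := hg
  choose! v hv using hPf
  choose! w hw using hQg
  have : Finite P := hP.1
  have : Finite Q := hQ.1
  have hp := partition_of_family
    (fun p : Q × P => p.1.1 ∩ {x | x + w p.1.1 ∈ p.2.1}) M ?_ ?_ ?_
  · refine ⟨_, hp, ?_⟩
    rintro _ ⟨⟨K, L⟩, rfl, -⟩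
    refine ⟨w K + v L, fun x hx => ?_⟩
    have hgx := hw K K.2 x hx.1
    have hfx := hv L L.2 (g x) (by rw [hgx]; exact hx.2)
    rw [Equiv.Perm.mul_apply, hfx, hgx, add_assoc]
  · rintro ⟨K, L⟩
    exact inter_rect_or_empty (hQ.2.1 K K.2) (translate_rect (hP.2.1 L L.2) _)
  · rintro ⟨K, L⟩ ⟨K', L'⟩ x hx hx'
    obtain rfl : K = K' := Subtype.ext (hQ.eq_of_mem K.2 K'.2 hx.1 hx'.1)
    obtain rfl : L = L' := Subtype.ext (hP.eq_of_mem L.2 L'.2 hx.2 hx'.2)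
    rfl
  · intro x
    constructor
    · intro hx
      obtain ⟨K, hK, hxK⟩ := hQ.exists_mem hx
      have hgx := hw K hK ⟨x, hx⟩ hxK
      obtain ⟨L, hL, hxL⟩ := hP.exists_mem (g ⟨x, hx⟩).2
      rw [hgx] at hxL
      exact ⟨(⟨K, hK⟩, ⟨L, hL⟩), hxK, hxL⟩
    · rintro ⟨⟨K, L⟩, hx⟩
      exact hQ.subset K.2 hx.1

theorem IsRectExchange.inv {d : ℕ} {M : Set (Fin d → ℝ)} {f : Equiv.Perm M}
    (hf : IsRectExchange M f) : IsRectExchange M f⁻¹ := by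
  obtain ⟨P, hP, hPf⟩ := hf
  choose! v hv using hPf
  have : Finite P := hP.1
  have hmem : ∀ (K : P) x, x + -v K.1 ∈ K.1 → ∃ y : M, y.1 ∈ K.1 ∧ (f y).1 = x := by
    intro K x hx
    refine ⟨⟨_, hP.subset K.2 hx⟩, hx, ?_⟩
    rw [hv K K.2 _ hx, neg_add_cancel_right]
  have hp := partition_of_family (fun K : P => {x | x + -v K.1 ∈ K.1}) M ?_ ?_ ?_
  · refine ⟨_, hp, ?_⟩
    rintro _ ⟨K, rfl, -⟩
    refine ⟨-v K.1, fun x hx => ?_⟩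
    obtain ⟨y, hy, hyx⟩ := hmem K x hx
    obtain rfl : f y = x := Subtype.ext hyx
    have hinv : f⁻¹ (f y) = y := f.symm_apply_apply y
    rw [hinv, hv K K.2 y hy, add_neg_cancel_right]
  · exact fun K => Or.inl (translate_rect (hP.2.1 K K.2) _)
  · intro K K' x hx hx'
    obtain ⟨y, hy, hyx⟩ := hmem K x hx
    obtain ⟨y', hy', hyx'⟩ := hmem K' x hx'
    obtain rfl : y = y' := f.injective (Subtype.ext (hyx.trans hyx'.symm))
    exact Subtype.ext (hP.eq_of_mem K.2 K'.2 hy hy')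
  · intro x
    constructor
    · intro hx
      obtain ⟨K, hK, hyK⟩ := hP.exists_mem (f⁻¹ ⟨x, hx⟩).2
      refine ⟨⟨K, hK⟩, ?_⟩
      have := hv K hK (f⁻¹ ⟨x, hx⟩) hyK
      have hinv : f (f⁻¹ ⟨x, hx⟩) = ⟨x, hx⟩ := f.apply_symm_apply _
      rw [hinv] at this
      have h2 : x + -v K = (f⁻¹ ⟨x, hx⟩).1 := by
        exact (eq_add_neg_of_add_eq this.symm).symm
      change x + -v K ∈ K
      rw [h2]
      exact hyK
    · rintro ⟨K, hx⟩
      obtain ⟨y, -, rfl⟩ := hmem K x hx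
      exact (f y).2

/-- `Rec_d(M)`: the group of rectangle exchange transformations of the multirectangle `M`. -/
def recGroup {d : ℕ} (M : Set (Fin d → ℝ)) (hM : IsMultirectangle M) :
    Subgroup (Equiv.Perm M) where
  carrier := {f | IsRectExchange M f}
  one_mem' := isRectExchange_one hM
  mul_mem' hf hg := hf.mul hg
  inv_mem' hf := hf.inv

/-- `f` is the rectangle transposition `τ_{P,Q}`: `P` and `Q` are disjoint rectangles contained in
`M`, `Q = P + v`, and `f` exchanges `P` and `Q` by translation and is the identity elsewhere. -/
def IsRectTransposition {d : ℕ} (M : Set (Fin d → ℝ)) (f : Equiv.Perm M)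
    (P Q : Set (Fin d → ℝ)) : Prop :=
  IsRectangle P ∧ IsRectangle Q ∧ P ⊆ M ∧ Q ⊆ M ∧ Disjoint P Q ∧
    ∃ v : Fin d → ℝ, Q = (fun x => x + v) '' P ∧
      ∀ x : M, ((x : Fin d → ℝ) ∈ P → (f x : Fin d → ℝ) = x + v) ∧
        ((x : Fin d → ℝ) ∈ Q → (f x : Fin d → ℝ) = x - v) ∧
        ((x : Fin d → ℝ) ∉ P → (x : Fin d → ℝ) ∉ Q → f x = x)

/-- The set of the transpositions in `Rec_d(M)` of two rectangles both contained in `U`. -/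
def transpositionsIn {d : ℕ} (M : Set (Fin d → ℝ)) (hM : IsMultirectangle M)
    (U : Set (Fin d → ℝ)) : Set (recGroup M hM) :=
  {f | ∃ P Q, IsRectTransposition M f.1 P Q ∧ P ⊆ U ∧ Q ⊆ U}

/-- The set of all rectangle transpositions in `Rec_d(M)`. -/
def transpositions {d : ℕ} (M : Set (Fin d → ℝ)) (hM : IsMultirectangle M) :
    Set (recGroup M hM) :=
  {f | ∃ P Q, IsRectTransposition M f.1 P Q}

/-- The set of the rectangle transpositions `τ_{P,Q}` in `Rec_d(M)` such that each of `P`, `Q` is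
contained in a cube of side length `ε` contained in `M`. -/
def smallTranspositions {d : ℕ} (M : Set (Fin d → ℝ)) (hM : IsMultirectangle M) (ε : ℝ) :
    Set (recGroup M hM) :=
  {f | ∃ P Q, IsRectTransposition M f.1 P Q ∧
    (∃ c, P ⊆ cube c ε ∧ cube c ε ⊆ M) ∧ (∃ c, Q ⊆ cube c ε ∧ cube c ε ⊆ M)}

end RectExchange

open RectExchange

/-!
Write `G` for the group of rectangle exchanges of `M` and `T` for its subgroup generated by the
rectangle transpositions. Everything rests on two tools. The first is `exists_swap_mem`: if `g` in
`G` moves a multirectangle `A` off itself, the involution exchanging `A` with `g A` is a product of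
rectangle transpositions, of pairs of rectangles as small as desired. In particular `T` is normal,
and it is generated by the small transpositions. The second is the packing lemma
`exists_mem_transpositionGroup_pack`: if `A` and `Z` are disjoint and the volume of `Z` is at least
`4 ^ d` times that of `A`, some element of `T` moves `A` into `Z`; this is a count of the cells of a
fine cubical grid.

`G / T` is abelian. Given `f` in `G` and a rectangle `C`, some `t` in `T` agrees with `f` off `C`
(`exists_mem_transpositionGroup_eq_off`). It is built by treating the complement of `C` in pieces
of small volume. Suppose `t` is already equal to `f` on `Y`, and let `X` be the next piece. The
room left outside `f Y`, `t X` and `f X` has volume at least that of `C` minus that of `X`, so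
`t X` can be packed there by some `h` in `T`; its new position is disjoint from `f X`, so the first
tool provides an element of `T` that brings it to `f X`. Hence two elements of `G` are, modulo `T`,
supported in two disjoint rectangles, and so commute modulo `T`. Conversely a transposition is a
commutator in `T` of elements with the same support, by cutting its two rectangles into halves
(`IsRectTransposition.exists_commutator_eq`). So `T` is the derived subgroup.

A subgroup normalized by `T` that contains the transpositions inside some `U` contains `T`
(`transpositionGroup_le_of_transpositionsIn`), because the packing lemma moves small rectangles
into `U`. If `n ≠ 1` belongs to a subgroup `N` normalized by `T`, it moves some rectangle `K` off
itself. For `α` and `g` in `T` supported in `K`, the commutator of `n α⁻¹ n⁻¹ α` with `g` is in `N`,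
and it equals the commutator of `α` with `g`. Thus `N` contains all the transpositions inside `K`,
and therefore `T` (`transpositionGroup_le_of_normalized`). Simplicity and the remaining assertions
follow.
-/

namespace RectExchange
open MeasureTheory

variable {d : ℕ}

/-! ### Multirectangles form a translation-invariant ring of sets -/

theorem IsRectangle.isMultirectangle {K : Set (Fin d → ℝ)} (hK : IsRectangle K) :
    IsMultirectangle K :=
  ⟨{K}, Set.finite_singleton K, by simpa using hK, Set.sUnion_singleton K⟩

theorem isMultirectangle_empty : IsMultirectangle (∅ : Set (Fin d → ℝ)) :=
  ⟨∅, Set.finite_empty, by simp, Set.sUnion_empty⟩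

theorem IsRectPartition.isMultirectangle {P : Set (Set (Fin d → ℝ))} {A : Set (Fin d → ℝ)}
    (h : IsRectPartition P A) : IsMultirectangle A :=
  ⟨P, h.1, h.2.1, h.2.2.2⟩

theorem IsMultirectangle.union {A B : Set (Fin d → ℝ)} (hA : IsMultirectangle A)
    (hB : IsMultirectangle B) : IsMultirectangle (A ∪ B) := by
  obtain ⟨P, hP, hPr, rfl⟩ := hA
  obtain ⟨Q, hQ, hQr, rfl⟩ := hB
  exact ⟨P ∪ Q, hP.union hQ, fun K hK => hK.elim (hPr K) (hQr K), Set.sUnion_union P Q⟩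

theorem isMultirectangle_sUnion {S : Set (Set (Fin d → ℝ))} (hS : S.Finite)
    (h : ∀ A ∈ S, IsMultirectangle A) : IsMultirectangle (⋃₀ S) := by
  induction S, hS using Set.Finite.induction_on with
  | empty => simpa using isMultirectangle_empty
  | @insert A S _ _ ih =>
    rw [Set.sUnion_insert]
    exact (h A (Set.mem_insert _ _)).union (ih fun B hB => h B (Set.mem_insert_of_mem _ hB))

theorem IsMultirectangle.inter {A B : Set (Fin d → ℝ)} (hA : IsMultirectangle A)
    (hB : IsMultirectangle B) : IsMultirectangle (A ∩ B) := by
  obtain ⟨P, hP, hPr, rfl⟩ := hA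
  obtain ⟨Q, hQ, hQr, rfl⟩ := hB
  have : ⋃₀ P ∩ ⋃₀ Q = ⋃₀ Set.image2 (· ∩ ·) P Q := by
    ext x
    simp only [Set.mem_inter_iff, Set.mem_sUnion, Set.mem_image2]
    grind
  rw [this]
  refine isMultirectangle_sUnion (hP.image2 _ hQ) ?_
  rintro _ ⟨K, hK, L, hL, rfl⟩
  rcases inter_rect_or_empty (hPr K hK) (hQr L hL) with h | h
  · exact h.isMultirectangle
  · simpa only [h] using isMultirectangle_empty

theorem IsMultirectangle.diff {A B : Set (Fin d → ℝ)} (hA : IsMultirectangle A)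
    (hB : IsMultirectangle B) : IsMultirectangle (A \ B) := by
  obtain ⟨Q, hQ, hQr, rfl⟩ := hB
  induction Q, hQ using Set.Finite.induction_on with
  | empty => simpa using hA
  | @insert L Q _ _ ih =>
    obtain ⟨P, hP, hPr, hPA⟩ := ih fun K hK => hQr K (Set.mem_insert_of_mem _ hK)
    have : A \ ⋃₀ insert L Q = ⋃₀ ((· \ L) '' P) := by
      rw [Set.sUnion_insert, Set.union_comm, ← Set.sdiff_sdiff, ← hPA]
      ext x
      simp only [Set.mem_sdiff, Set.mem_sUnion, Set.mem_image]
      grind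
    rw [this]
    refine isMultirectangle_sUnion (hP.image _) ?_
    rintro _ ⟨K, hK, rfl⟩
    obtain ⟨R, hR⟩ := exists_partition_diff (hPr K hK) (hQr L (Set.mem_insert _ _))
    exact hR.isMultirectangle

theorem image_add_eq_setOf (A : Set (Fin d → ℝ)) (v : Fin d → ℝ) :
    (fun x => x + v) '' A = {x | x + -v ∈ A} := by
  rw [Set.image_add_right]
  rfl

theorem IsRectangle.image_add {K : Set (Fin d → ℝ)} (hK : IsRectangle K) (v : Fin d → ℝ) :
    IsRectangle ((fun x => x + v) '' K) := by
  rw [image_add_eq_setOf]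
  exact translate_rect hK _

theorem IsMultirectangle.image_add {A : Set (Fin d → ℝ)} (hA : IsMultirectangle A)
    (v : Fin d → ℝ) : IsMultirectangle ((fun x => x + v) '' A) := by
  obtain ⟨P, hP, hPr, rfl⟩ := hA
  rw [Set.image_sUnion]
  refine isMultirectangle_sUnion (hP.image _) ?_
  rintro _ ⟨K, hK, rfl⟩
  exact ((hPr K hK).image_add v).isMultirectangle

theorem IsRectangle.nonempty {K : Set (Fin d → ℝ)} (hK : IsRectangle K) : K.Nonempty := by
  obtain ⟨a, b, h, rfl⟩ := hK
  exact ⟨a, mem_box.2 fun i => ⟨le_rfl, h i⟩⟩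

theorem isRectangle_cube (c : Fin d → ℝ) {ε : ℝ} (hε : 0 < ε) : IsRectangle (cube c ε) :=
  ⟨c, fun i => c i + ε, fun i => by linarith, rfl⟩

/-! ### Refinement of finite coverings to partitions -/

/-- A finite covering of a multirectangle by multirectangles is refined by some finite partition
into rectangles. -/
theorem IsMultirectangle.exists_partition_of_cover {A : Set (Fin d → ℝ)} (hA : IsMultirectangle A)
    {S : Set (Set (Fin d → ℝ))} (hS : S.Finite) (hSm : ∀ B ∈ S, IsMultirectangle B)
    (hcov : A ⊆ ⋃₀ S) : ∃ P, IsRectPartition P A ∧ ∀ K ∈ P, ∃ B ∈ S, K ⊆ B := by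
  induction S, hS using Set.Finite.induction_on generalizing A with
  | empty =>
    obtain rfl : A = ∅ := by simpa using hcov
    exact ⟨∅, by simp [IsRectPartition], by simp⟩
  | @insert B S _ _ ih =>
    have hB := hSm B (Set.mem_insert _ _)
    obtain ⟨P, hP, hPS⟩ := ih (hA.diff hB) (fun C hC => hSm C (Set.mem_insert_of_mem _ hC))
      (by
        rintro x ⟨hxA, hxB⟩
        have := hcov hxA
        rw [Set.sUnion_insert] at this
        exact this.resolve_left hxB)
    obtain ⟨Q, hQ⟩ := (hA.inter hB).exists_partition
    refine ⟨P ∪ Q, ⟨hP.1.union hQ.1, fun K hK => hK.elim (hP.2.1 K) (hQ.2.1 K), ?_, ?_⟩, ?_⟩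
    · rw [Set.pairwiseDisjoint_union]
      refine ⟨hP.2.2.1, hQ.2.2.1, fun K hK L hL _ => Set.disjoint_left.2 fun x hx hx' => ?_⟩
      exact (hP.subset hK hx).2 (hQ.subset hL hx').2
    · rw [Set.sUnion_union, hP.2.2.2, hQ.2.2.2, Set.union_comm, Set.inter_union_sdiff]
    · rintro K (hK | hK)
      · obtain ⟨C, hC, h⟩ := hPS K hK
        exact ⟨C, Set.mem_insert_of_mem _ hC, h⟩
      · exact ⟨B, Set.mem_insert _ _, fun x hx => (hQ.subset hK hx).2⟩

/-- A property of subsets of `ℝ^d` is refinable if it passes to subsets and every multirectangle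
is covered by finitely many multirectangles having the property. -/
structure Refinable (p : Set (Fin d → ℝ) → Prop) : Prop where
  mono : ∀ K L, L ⊆ K → p K → p L
  cover : ∀ A, IsMultirectangle A → ∃ S : Set (Set (Fin d → ℝ)), S.Finite ∧
    (∀ B ∈ S, IsMultirectangle B ∧ p B) ∧ A ⊆ ⋃₀ S

theorem Refinable.exists_partition {p : Set (Fin d → ℝ) → Prop} (hp : Refinable p)
    {A : Set (Fin d → ℝ)} (hA : IsMultirectangle A) :
    ∃ P, IsRectPartition P A ∧ ∀ K ∈ P, p K := by
  obtain ⟨S, hS, hSp, hcov⟩ := hp.cover A hA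
  obtain ⟨P, hP, hPS⟩ := hA.exists_partition_of_cover hS (fun B hB => (hSp B hB).1) hcov
  refine ⟨P, hP, fun K hK => ?_⟩
  obtain ⟨B, hB, hKB⟩ := hPS K hK
  exact hp.mono B K hKB (hSp B hB).2

theorem refinable_true : Refinable (fun _ : Set (Fin d → ℝ) => True) :=
  ⟨fun _ _ _ _ => trivial, fun A hA =>
    ⟨{A}, Set.finite_singleton A, by simpa using hA, (Set.sUnion_singleton A).ge⟩⟩

theorem Refinable.and {p q : Set (Fin d → ℝ) → Prop} (hp : Refinable p) (hq : Refinable q) :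
    Refinable fun K => p K ∧ q K := by
  refine ⟨fun K L h hK => ⟨hp.mono K L h hK.1, hq.mono K L h hK.2⟩, fun A hA => ?_⟩
  obtain ⟨S, hS, hSp, hSA⟩ := hp.cover A hA
  obtain ⟨S', hS', hSq, hSA'⟩ := hq.cover A hA
  refine ⟨Set.image2 (· ∩ ·) S S', hS.image2 _ hS', ?_, fun x hx => ?_⟩
  · rintro _ ⟨B, hB, B', hB', rfl⟩
    exact ⟨(hSp B hB).1.inter (hSq B' hB').1, hp.mono _ _ Set.inter_subset_left (hSp B hB).2,
      hq.mono _ _ Set.inter_subset_right (hSq B' hB').2⟩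
  · obtain ⟨B, hB, hxB⟩ := hSA hx
    obtain ⟨B', hB', hxB'⟩ := hSA' hx
    exact ⟨B ∩ B', ⟨B, hB, B', hB', rfl⟩, hxB, hxB'⟩

/-- Induction on multirectangles: it suffices to treat rectangles having a given refinable
property, and disjoint unions. -/
@[elab_as_elim]
theorem IsMultirectangle.induction {C p : Set (Fin d → ℝ) → Prop} (hp : Refinable p)
    (empty : C ∅) (rect : ∀ K, IsRectangle K → p K → C K)
    (union : ∀ A B, IsMultirectangle A → IsMultirectangle B → Disjoint A B →
      C A → C B → C (A ∪ B)) {A : Set (Fin d → ℝ)} (hA : IsMultirectangle A) : C A := by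
  obtain ⟨P, ⟨hfin, hrect, hdisj, rfl⟩, hPp⟩ := hp.exists_partition hA
  clear hA
  induction P, hfin using Set.Finite.induction_on with
  | empty => simpa using empty
  | @insert K P hKP hfin ih =>
    have hmem : ∀ L ∈ P, L ∈ insert K P := fun L hL => Set.mem_insert_of_mem _ hL
    have hK : K ∈ insert K P := Set.mem_insert _ _
    rw [Set.sUnion_insert]
    refine union _ _ (hrect K hK).isMultirectangle
      ⟨P, hfin, fun L hL => hrect L (hmem L hL), rfl⟩ ?_ (rect K (hrect K hK) (hPp K hK))
      (ih (fun L hL => hPp L (hmem L hL)) (fun L hL => hrect L (hmem L hL))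
        (hdisj.subset (Set.subset_insert _ _)))
    rw [Set.disjoint_sUnion_right]
    exact fun L hL => hdisj hK (hmem L hL) fun h => hKP (h ▸ hL)

/-- Being contained in a cube of given side is a refinable property. -/
theorem refinable_subset_cube {ε : ℝ} (hε : 0 < ε) :
    Refinable fun K : Set (Fin d → ℝ) => ∃ c, K ⊆ cube c ε := by
  refine ⟨fun K L h ⟨c, hc⟩ => ⟨c, h.trans hc⟩, ?_⟩
  rintro _ ⟨P, hP, hPr, rfl⟩
  have key : ∀ K ∈ P, ∃ S : Set (Set (Fin d → ℝ)), S.Finite ∧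
      (∀ B ∈ S, IsMultirectangle B ∧ ∃ c, B ⊆ cube c ε) ∧ K ⊆ ⋃₀ S := by
    intro K hK
    obtain ⟨a, b, -, rfl⟩ := hPr K hK
    refine ⟨(fun z : Fin d → ℕ => cube (fun i => a i + z i * ε) ε) ''
      ↑(Fintype.piFinset fun i => Finset.range (⌊(b i - a i) / ε⌋₊ + 1)),
      (Finset.finite_toSet _).image _, ?_, fun x hx => ?_⟩
    · rintro _ ⟨z, -, rfl⟩
      exact ⟨(isRectangle_cube _ hε).isMultirectangle, _, subset_rfl⟩
    · rw [mem_box] at hx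
      refine ⟨_, ⟨fun i => ⌊(x i - a i) / ε⌋₊, ?_, rfl⟩, ?_⟩
      · simp only [Finset.mem_coe, Fintype.mem_piFinset, Finset.mem_range, Nat.lt_succ_iff]
        intro i
        have := (hx i).2
        gcongr
      · refine mem_box.2 fun i => ?_
        have h0 : 0 ≤ (x i - a i) / ε := div_nonneg (by linarith [(hx i).1]) hε.le
        have h1 := (le_div_iff₀ hε).1 (Nat.floor_le h0)
        have h2 := (div_lt_iff₀ hε).1 (Nat.lt_floor_add_one ((x i - a i) / ε))
        constructor <;> linarith
  choose! S hS hSp hSK using key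
  refine ⟨⋃ K ∈ P, S K, hP.biUnion hS, ?_, ?_⟩
  · intro B hB
    simp only [Set.mem_iUnion] at hB
    obtain ⟨K, hK, hB⟩ := hB
    exact hSp K hK B hB
  · rintro x ⟨K, hK, hx⟩
    obtain ⟨B, hB, hxB⟩ := hSK K hK hx
    exact ⟨B, Set.mem_biUnion hK hB, hxB⟩

/-! ### Images of multirectangles under rectangle exchanges -/

theorem refinable_translates {M : Set (Fin d → ℝ)} {g : Equiv.Perm M} (hM : IsMultirectangle M)
    (hg : IsRectExchange M g) : Refinable fun K : Set (Fin d → ℝ) =>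
      ∃ v : Fin d → ℝ, ∀ x : M, (x : Fin d → ℝ) ∈ K → (g x : Fin d → ℝ) = x + v := by
  refine ⟨fun K L h ⟨v, hv⟩ => ⟨v, fun x hx => hv x (h hx)⟩, fun A hA => ?_⟩
  obtain ⟨P, hP, hPg⟩ := hg
  refine ⟨insert (A \ M) P, hP.1.insert _, ?_, fun x hx => ?_⟩
  · rintro B (rfl | hB)
    · exact ⟨hA.diff hM, 0, fun x hx => absurd x.2 hx.2⟩
    · exact ⟨(hP.2.1 B hB).isMultirectangle, hPg B hB⟩
  · by_cases hxM : x ∈ M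
    · obtain ⟨K, hK, hxK⟩ := hP.exists_mem hxM
      exact ⟨K, Set.mem_insert_of_mem _ hK, hxK⟩
    · exact ⟨A \ M, Set.mem_insert _ _, hx, hxM⟩

theorem isRectExchange_of_cover {M : Set (Fin d → ℝ)} {g : Equiv.Perm M} (hM : IsMultirectangle M)
    {S : Set (Set (Fin d → ℝ))} (hS : S.Finite) (hSm : ∀ B ∈ S, IsMultirectangle B)
    (hcov : M ⊆ ⋃₀ S)
    (hg : ∀ B ∈ S, ∃ v : Fin d → ℝ, ∀ x : M, (x : Fin d → ℝ) ∈ B → (g x : Fin d → ℝ) = x + v) :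
    IsRectExchange M g := by
  obtain ⟨P, hP, hPS⟩ := hM.exists_partition_of_cover hS hSm hcov
  refine ⟨P, hP, fun K hK => ?_⟩
  obtain ⟨B, hB, hKB⟩ := hPS K hK
  obtain ⟨v, hv⟩ := hg B hB
  exact ⟨v, fun x hx => hv x (hKB hx)⟩

theorem perm_apply_inv {α : Type*} (g : Equiv.Perm α) (x : α) : g (g⁻¹ x) = x :=
  g.apply_symm_apply x

theorem perm_inv_apply {α : Type*} (g : Equiv.Perm α) (x : α) : g⁻¹ (g x) = x :=
  g.symm_apply_apply x

/-- The image under a permutation of `M` of (the part in `M` of) a set of points of `ℝ^d`. -/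
def img {M : Set (Fin d → ℝ)} (g : Equiv.Perm M) (A : Set (Fin d → ℝ)) : Set (Fin d → ℝ) :=
  {y | ∃ x : M, (x : Fin d → ℝ) ∈ A ∧ (g x : Fin d → ℝ) = y}

theorem img_subset {M : Set (Fin d → ℝ)} (g : Equiv.Perm M) (A : Set (Fin d → ℝ)) :
    img g A ⊆ M := by
  rintro _ ⟨x, -, rfl⟩
  exact (g x).2

theorem apply_mem_img {M : Set (Fin d → ℝ)} {g : Equiv.Perm M} {A : Set (Fin d → ℝ)} {x : M} :
    (g x : Fin d → ℝ) ∈ img g A ↔ (x : Fin d → ℝ) ∈ A := by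
  constructor
  · rintro ⟨y, hy, h⟩
    rwa [← g.injective (Subtype.ext h)]
  · exact fun h => ⟨x, h, rfl⟩

theorem mem_img_iff {M : Set (Fin d → ℝ)} {g : Equiv.Perm M} {A : Set (Fin d → ℝ)} {x : M} :
    (x : Fin d → ℝ) ∈ img g A ↔ (g⁻¹ x : Fin d → ℝ) ∈ A := by
  rw [← apply_mem_img (g := g) (x := g⁻¹ x), perm_apply_inv]

theorem img_union {M : Set (Fin d → ℝ)} (g : Equiv.Perm M) (A B : Set (Fin d → ℝ)) :
    img g (A ∪ B) = img g A ∪ img g B := by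
  ext y
  simp only [img, Set.mem_ofPred_eq, Set.mem_union]
  grind

theorem img_empty {M : Set (Fin d → ℝ)} (g : Equiv.Perm M) : img g ∅ = ∅ := by
  simp [img]

theorem disjoint_img {M : Set (Fin d → ℝ)} (g : Equiv.Perm M) {A B : Set (Fin d → ℝ)}
    (h : Disjoint A B) : Disjoint (img g A) (img g B) := by
  rw [Set.disjoint_left]
  rintro _ ⟨x, hx, rfl⟩ h2
  exact Set.disjoint_left.1 h hx (apply_mem_img.1 h2)

theorem img_eq_image_add {M : Set (Fin d → ℝ)} {g : Equiv.Perm M} {K : Set (Fin d → ℝ)}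
    {v : Fin d → ℝ} (hv : ∀ x : M, (x : Fin d → ℝ) ∈ K → (g x : Fin d → ℝ) = x + v) :
    img g K = (fun x => x + v) '' (K ∩ M) := by
  ext y
  constructor
  · rintro ⟨x, hx, rfl⟩
    exact ⟨x, ⟨hx, x.2⟩, (hv x hx).symm⟩
  · rintro ⟨x, ⟨hx, hxM⟩, rfl⟩
    exact ⟨⟨x, hxM⟩, hx, hv _ hx⟩

theorem isMultirectangle_img {M : Set (Fin d → ℝ)} {g : Equiv.Perm M} (hM : IsMultirectangle M)
    (hg : IsRectExchange M g) {A : Set (Fin d → ℝ)} (hA : IsMultirectangle A) :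
    IsMultirectangle (img g A) := by
  refine IsMultirectangle.induction (refinable_translates hM hg) ?_ ?_ ?_ hA
  · rw [img_empty]
    exact isMultirectangle_empty
  · rintro K hK ⟨v, hv⟩
    rw [img_eq_image_add hv]
    exact (hK.isMultirectangle.inter hM).image_add v
  · intro A B _ _ _ hA hB
    rw [img_union]
    exact hA.union hB

theorem IsMultirectangle.measurableSet {A : Set (Fin d → ℝ)} (hA : IsMultirectangle A) :
    MeasurableSet A := by
  obtain ⟨P, hP, hPr, rfl⟩ := hA
  refine MeasurableSet.sUnion hP.countable fun K hK => ?_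
  obtain ⟨a, b, -, rfl⟩ := hPr K hK
  exact MeasurableSet.univ_pi fun i => measurableSet_Ico

theorem IsMultirectangle.volume_ne_top {A : Set (Fin d → ℝ)} (hA : IsMultirectangle A) :
    volume A ≠ ⊤ := by
  refine hA.induction refinable_true (by simp) ?_ ?_ hA
  · rintro _ ⟨a, b, -, rfl⟩ - -
    rw [Real.volume_pi_Ico]
    exact ENNReal.prod_ne_top fun i _ => ENNReal.ofReal_ne_top
  · exact fun A B hA hB _ ihA ihB _ => measure_union_ne_top (ihA hA) (ihB hB)

theorem volume_real_image_add (A : Set (Fin d → ℝ)) (v : Fin d → ℝ) :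
    volume.real ((fun x => x + v) '' A) = volume.real A := by
  rw [Set.image_add_right, measureReal_def, measure_preimage_add_right, measureReal_def]

theorem IsMultirectangle.volume_union {A B : Set (Fin d → ℝ)} (hA : IsMultirectangle A)
    (hB : IsMultirectangle B) (h : Disjoint A B) :
    volume.real (A ∪ B) = volume.real A + volume.real B :=
  measureReal_union h hB.measurableSet hA.volume_ne_top hB.volume_ne_top

/-- Rectangle exchanges preserve the volume. -/
theorem IsMultirectangle.volume_img {M : Set (Fin d → ℝ)} {g : Equiv.Perm M}
    (hM : IsMultirectangle M) (hg : IsRectExchange M g) {A : Set (Fin d → ℝ)}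
    (hA : IsMultirectangle A) (hAM : A ⊆ M) : volume.real (img g A) = volume.real A := by
  revert hAM
  refine IsMultirectangle.induction (refinable_translates hM hg) ?_ ?_ ?_ hA
  · simp [img_empty]
  · rintro K hK ⟨v, hv⟩ hKM
    rw [img_eq_image_add hv, volume_real_image_add, Set.inter_eq_left.2 hKM]
  · intro A B hA hB hAB ihA ihB hM'
    rw [Set.union_subset_iff] at hM'
    rw [img_union, (isMultirectangle_img hM hg hA).volume_union
      (isMultirectangle_img hM hg hB) (disjoint_img g hAB), hA.volume_union hB hAB,
      ihA hM'.1, ihB hM'.2]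

/-! ### Swaps -/

/-- The permutation `s` exchanges `A` with its image under `g`: it is `g` on `A`, `g⁻¹` on the
image of `A`, and the identity elsewhere. -/
def IsSwapOf {M : Set (Fin d → ℝ)} (s g : Equiv.Perm M) (A : Set (Fin d → ℝ)) : Prop :=
  ∀ x : M, ((x : Fin d → ℝ) ∈ A → s x = g x) ∧ ((g⁻¹ x : Fin d → ℝ) ∈ A → s x = g⁻¹ x) ∧
    ((x : Fin d → ℝ) ∉ A → (g⁻¹ x : Fin d → ℝ) ∉ A → s x = x)

theorem IsSwapOf.unique {M : Set (Fin d → ℝ)} {s t g : Equiv.Perm M} {A : Set (Fin d → ℝ)}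
    (hs : IsSwapOf s g A) (ht : IsSwapOf t g A) : s = t := by
  ext1 x
  by_cases h : (x : Fin d → ℝ) ∈ A
  · rw [(hs x).1 h, (ht x).1 h]
  by_cases h' : (g⁻¹ x : Fin d → ℝ) ∈ A
  · rw [(hs x).2.1 h', (ht x).2.1 h']
  · rw [(hs x).2.2 h h', (ht x).2.2 h h']

theorem isSwapOf_empty {M : Set (Fin d → ℝ)} (g : Equiv.Perm M) : IsSwapOf 1 g ∅ :=
  fun x => by simp

theorem IsSwapOf.mul {M : Set (Fin d → ℝ)} {s t g : Equiv.Perm M} {A B : Set (Fin d → ℝ)}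
    (hs : IsSwapOf s g A) (ht : IsSwapOf t g B) (hAB : Disjoint A B)
    (h : ∀ x : M, (x : Fin d → ℝ) ∈ A ∪ B → (g x : Fin d → ℝ) ∉ A ∪ B) :
    IsSwapOf (s * t) g (A ∪ B) := by
  intro x
  have h0 := h x
  have h1 := h (g⁻¹ x)
  have h2 := h (g⁻¹ (g⁻¹ x))
  have hd := fun y => fun (h : y ∈ A) => Set.disjoint_left.1 hAB h
  have s1 := hs x
  have t1 := ht x
  have s2 := hs (g x)
  have s3 := hs (g⁻¹ x)
  simp only [Equiv.Perm.mul_apply, Set.mem_union, perm_apply_inv, perm_inv_apply] at *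
  clear h hs ht hAB
  have hd0 := hd x
  have hd1 := hd (g⁻¹ x)
  clear hd
  refine ⟨?_, ?_, ?_⟩
  · rintro (hx | hx) <;> grind
  · rintro (hx | hx) <;> grind
  · grind

/-- The transposition of a multirectangle with a disjoint translate of it is a rectangle
exchange. -/
theorem exists_translation_swap {M : Set (Fin d → ℝ)} (hM : IsMultirectangle M)
    {A : Set (Fin d → ℝ)} (hA : IsMultirectangle A) (v : Fin d → ℝ) (hAM : A ⊆ M)
    (hvM : ∀ x ∈ A, x + v ∈ M) (hdisj : ∀ x ∈ A, x + v ∉ A) :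
    ∃ s : recGroup M hM, ∀ x : M, ((x : Fin d → ℝ) ∈ A → (s.1 x : Fin d → ℝ) = x + v) ∧
      ((x : Fin d → ℝ) - v ∈ A → (s.1 x : Fin d → ℝ) = x - v) ∧
      ((x : Fin d → ℝ) ∉ A → (x : Fin d → ℝ) - v ∉ A → s.1 x = x) := by
  classical
  let F : M → M := fun x => if h : (x : Fin d → ℝ) ∈ A then ⟨x + v, hvM x h⟩ else
    if h' : (x : Fin d → ℝ) - v ∈ A then ⟨x - v, hAM h'⟩ else x
  have hF : ∀ x : M, ((x : Fin d → ℝ) ∈ A → (F x : Fin d → ℝ) = x + v) ∧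
      ((x : Fin d → ℝ) - v ∈ A → (F x : Fin d → ℝ) = x - v) ∧
      ((x : Fin d → ℝ) ∉ A → (x : Fin d → ℝ) - v ∉ A → F x = x) := by
    intro x
    have := hdisj (x - v)
    rw [sub_add_cancel] at this
    simp only [F]
    refine ⟨?_, ?_, ?_⟩ <;> grind
  have hinv : Function.Involutive F := by
    intro x
    apply Subtype.ext
    by_cases h : (x : Fin d → ℝ) ∈ A
    · have h1 := (hF x).1 h
      have h2 := (hF (F x)).2.1 (by rwa [h1, add_sub_cancel_right])
      rw [h2, h1, add_sub_cancel_right]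
    by_cases h' : (x : Fin d → ℝ) - v ∈ A
    · have h1 := (hF x).2.1 h'
      have h2 := (hF (F x)).1 (by rwa [h1])
      rw [h2, h1, sub_add_cancel]
    · rw [(hF x).2.2 h h', (hF x).2.2 h h']
  refine ⟨⟨hinv.toPerm, ?_⟩, hF⟩
  have hA' := hA.image_add v
  have hmem : ∀ x, x ∈ (fun x => x + v) '' A ↔ x - v ∈ A := fun x => by
    rw [image_add_eq_setOf, sub_eq_add_neg]
    rfl
  refine isRectExchange_of_cover hM
    (S := {A, (fun x => x + v) '' A, M \ (A ∪ (fun x => x + v) '' A)}) (by simp) ?_ ?_ ?_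
  · rintro B (rfl | rfl | rfl)
    exacts [hA, hA', hM.diff (hA.union hA')]
  · intro x hx
    simp only [Set.sUnion_insert, Set.sUnion_singleton, Set.mem_union, Set.mem_sdiff]
    tauto
  · rintro B (rfl | rfl | rfl)
    · exact ⟨v, fun x hx => (hF x).1 hx⟩
    · exact ⟨-v, fun x hx => by
        rw [← sub_eq_add_neg]
        exact (hF x).2.1 ((hmem x).1 hx)⟩
    · refine ⟨0, fun x hx => ?_⟩
      have hx2 := hx.2
      rw [Set.mem_union, hmem, not_or] at hx2
      rw [add_zero]
      exact congrArg Subtype.val ((hF x).2.2 hx2.1 hx2.2)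

/-- A swap of a rectangle with a translate is a rectangle transposition. -/
theorem IsSwapOf.isRectTransposition {M : Set (Fin d → ℝ)} {s g : Equiv.Perm M}
    {K : Set (Fin d → ℝ)} (hs : IsSwapOf s g K) (hK : IsRectangle K) (hKM : K ⊆ M)
    {v : Fin d → ℝ} (hv : ∀ x : M, (x : Fin d → ℝ) ∈ K → (g x : Fin d → ℝ) = x + v)
    (hdisj : ∀ x : M, (x : Fin d → ℝ) ∈ K → (g x : Fin d → ℝ) ∉ K) :
    IsRectTransposition M s K (img g K) := by
  have himg := img_eq_image_add hv
  rw [Set.inter_eq_left.2 hKM] at himg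
  refine ⟨hK, himg ▸ hK.image_add v, hKM, img_subset g K, ?_, v, himg, fun x => ⟨?_, ?_, ?_⟩⟩
  · rw [Set.disjoint_right]
    rintro _ ⟨x, hx, rfl⟩
    exact hdisj x hx
  · intro hx
    rw [(hs x).1 hx, hv x hx]
  · intro hx
    have hx := mem_img_iff.1 hx
    have := hv _ hx
    rw [perm_apply_inv] at this
    rw [(hs x).2.1 hx, this, add_sub_cancel_right]
  · intro hx hx'
    exact (hs x).2.2 hx fun h => hx' (mem_img_iff.2 h)

theorem IsRectTransposition.img_eq {M : Set (Fin d → ℝ)} {s : Equiv.Perm M}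
    {P Q : Set (Fin d → ℝ)} (h : IsRectTransposition M s P Q) : img s P = Q := by
  obtain ⟨-, -, hP, -, -, v, rfl, hv⟩ := h
  rw [img_eq_image_add fun x hx => (hv x).1 hx, Set.inter_eq_left.2 hP]

theorem IsRectTransposition.apply_apply {M : Set (Fin d → ℝ)} {s : Equiv.Perm M}
    {P Q : Set (Fin d → ℝ)} (h : IsRectTransposition M s P Q) (x : M) : s (s x) = x := by
  obtain ⟨-, -, -, -, -, v, rfl, hv⟩ := h
  by_cases h1 : (x : Fin d → ℝ) ∈ P
  · have h2 := (hv x).1 h1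
    apply Subtype.ext
    rw [(hv (s x)).2.1 (h2 ▸ ⟨x, h1, rfl⟩), h2, add_sub_cancel_right]
  by_cases h1' : (x : Fin d → ℝ) ∈ (fun x => x + v) '' P
  · have h2 := (hv x).2.1 h1'
    apply Subtype.ext
    rw [(hv (s x)).1, h2, sub_add_cancel]
    obtain ⟨y, hy, hyx⟩ := h1'
    rw [h2, ← hyx]
    simpa using hy
  · rw [(hv x).2.2 h1 h1', (hv x).2.2 h1 h1']

theorem IsRectTransposition.inv_eq {M : Set (Fin d → ℝ)} {s : Equiv.Perm M}
    {P Q : Set (Fin d → ℝ)} (h : IsRectTransposition M s P Q) : s⁻¹ = s := by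
  ext1 x
  rw [Equiv.Perm.inv_eq_iff_eq, h.apply_apply]

theorem IsRectTransposition.notMem_of_mem {M : Set (Fin d → ℝ)} {s : Equiv.Perm M}
    {P Q : Set (Fin d → ℝ)} (h : IsRectTransposition M s P Q) (x : M)
    (hx : (x : Fin d → ℝ) ∈ P) : (s x : Fin d → ℝ) ∉ P := by
  rw [← h.img_eq] at h
  exact fun h' => Set.disjoint_left.1 h.2.2.2.2.1 h' ⟨x, hx, rfl⟩

/-- A rectangle transposition `s` with rectangles `P` and `Q` swaps `P` with its image by `s`. -/
theorem IsRectTransposition.isSwapOf {M : Set (Fin d → ℝ)} {s : Equiv.Perm M}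
    {P Q : Set (Fin d → ℝ)} (h : IsRectTransposition M s P Q) : IsSwapOf s s P := by
  refine fun x => ⟨fun _ => rfl, fun _ => by rw [h.inv_eq], fun h1 h2 => ?_⟩
  rw [← mem_img_iff, h.img_eq] at h2
  obtain ⟨-, -, -, -, -, v, -, hv⟩ := h
  exact (hv x).2.2 h1 h2

/-- If `g` is a rectangle exchange moving `A` off itself, then the swap of `A` with its image by
`g` belongs to every subgroup that contains the transpositions of the pairs `K`, `g K` for the
rectangles `K ⊆ A` with a given refinable property. -/
theorem exists_swap_mem {M : Set (Fin d → ℝ)} (hM : IsMultirectangle M)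
    (H : Subgroup (recGroup M hM)) (g : recGroup M hM) {p : Set (Fin d → ℝ) → Prop}
    (hp : Refinable p) {A : Set (Fin d → ℝ)} (hA : IsMultirectangle A) (hAM : A ⊆ M)
    (hdisj : ∀ x : M, (x : Fin d → ℝ) ∈ A → (g.1 x : Fin d → ℝ) ∉ A)
    (hH : ∀ K ⊆ A, p K → ∀ s : recGroup M hM, IsRectTransposition M s.1 K (img g.1 K) → s ∈ H) :
    ∃ s ∈ H, IsSwapOf s.1 g.1 A := by
  revert hAM hdisj hH
  refine IsMultirectangle.induction (hp.and (refinable_translates hM g.2)) ?_ ?_ ?_ hA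
  · exact fun _ _ _ => ⟨1, H.one_mem, isSwapOf_empty _⟩
  · rintro K hK ⟨hpK, v, hv⟩ hKM hdisj hH
    have hv' : ∀ x (hx : x ∈ K), (g.1 ⟨x, hKM hx⟩ : Fin d → ℝ) = x + v := fun x hx => hv _ hx
    obtain ⟨s, hs⟩ := exists_translation_swap hM hK.isMultirectangle v hKM
      (fun x hx => hv' x hx ▸ (g.1 ⟨x, hKM hx⟩).2) (fun x hx => hv' x hx ▸ hdisj _ hx)
    have hswap : IsSwapOf s.1 g.1 K := by
      refine fun x => ⟨fun hx => Subtype.ext ?_, fun hx => Subtype.ext ?_, fun hx hx' => ?_⟩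
      · rw [(hs x).1 hx, hv x hx]
      · have := hv _ hx
        rw [perm_apply_inv] at this
        have h2 := eq_sub_of_add_eq this.symm
        rw [(hs x).2.1 (h2 ▸ hx), h2]
      · refine (hs x).2.2 hx fun h => hx' ?_
        have h2 : g.1 ⟨_, hKM h⟩ = x := Subtype.ext (by rw [hv' _ h, sub_add_cancel])
        rw [← h2, perm_inv_apply]
        exact h
    exact ⟨s, hH K subset_rfl hpK s (hswap.isRectTransposition hK hKM hv hdisj), hswap⟩
  · intro A B _ _ hAB ihA ihB hAM hdisj hH
    rw [Set.union_subset_iff] at hAM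
    obtain ⟨s, hsH, hs⟩ := ihA hAM.1
      (fun x hx h => hdisj x (Or.inl hx) (Or.inl h))
      fun K hK => hH K (hK.trans Set.subset_union_left)
    obtain ⟨t, htH, ht⟩ := ihB hAM.2
      (fun x hx h => hdisj x (Or.inr hx) (Or.inr h))
      fun K hK => hH K (hK.trans Set.subset_union_right)
    exact ⟨s * t, H.mul_mem hsH htH, hs.mul ht hAB hdisj⟩

/-- A rectangle exchange that is a swap of `A` with its image lies in every subgroup that contains
the transpositions of the pairs `K`, `g K` for the rectangles `K ⊆ A` with a given refinable
property. -/
theorem mem_of_isSwapOf_self {M : Set (Fin d → ℝ)} (hM : IsMultirectangle M)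
    (H : Subgroup (recGroup M hM)) (g : recGroup M hM) {p : Set (Fin d → ℝ) → Prop}
    (hp : Refinable p) {A : Set (Fin d → ℝ)} (hA : IsMultirectangle A) (hAM : A ⊆ M)
    (hdisj : ∀ x : M, (x : Fin d → ℝ) ∈ A → (g.1 x : Fin d → ℝ) ∉ A) (hg : IsSwapOf g.1 g.1 A)
    (hH : ∀ K ⊆ A, p K → ∀ s : recGroup M hM, IsRectTransposition M s.1 K (img g.1 K) → s ∈ H) :
    g ∈ H := by
  obtain ⟨s, hs, hsw⟩ := exists_swap_mem hM H g hp hA hAM hdisj hH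
  rwa [← (Subtype.ext (hsw.unique hg) : s = g)]

theorem IsSwapOf.conj {M : Set (Fin d → ℝ)} {s g : Equiv.Perm M} {A : Set (Fin d → ℝ)}
    (hs : IsSwapOf s g A) (h : Equiv.Perm M) :
    IsSwapOf (h * s * h⁻¹) (h * g * h⁻¹) (img h A) := by
  intro x
  obtain ⟨y, rfl⟩ := h.surjective x
  simp only [mul_inv_rev, inv_inv, Equiv.Perm.mul_apply, perm_inv_apply, apply_mem_img,
    EmbeddingLike.apply_eq_iff_eq]
  exact hs y

/-- The group generated by the rectangle transpositions. -/
def transpositionGroup (M : Set (Fin d → ℝ)) (hM : IsMultirectangle M) :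
    Subgroup (recGroup M hM) :=
  Subgroup.closure (transpositions M hM)

theorem exists_swap_mem_transpositionGroup {M : Set (Fin d → ℝ)} (hM : IsMultirectangle M)
    (g : recGroup M hM) {A : Set (Fin d → ℝ)} (hA : IsMultirectangle A) (hAM : A ⊆ M)
    (hdisj : ∀ x : M, (x : Fin d → ℝ) ∈ A → (g.1 x : Fin d → ℝ) ∉ A) :
    ∃ s ∈ transpositionGroup M hM, IsSwapOf s.1 g.1 A :=
  exists_swap_mem hM _ g refinable_true hA hAM hdisj
    fun _ _ _ _ hs => Subgroup.subset_closure ⟨_, _, hs⟩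

theorem mem_transpositionGroup_of_isSwapOf_self {M : Set (Fin d → ℝ)} (hM : IsMultirectangle M)
    (g : recGroup M hM) {A : Set (Fin d → ℝ)} (hA : IsMultirectangle A) (hAM : A ⊆ M)
    (hdisj : ∀ x : M, (x : Fin d → ℝ) ∈ A → (g.1 x : Fin d → ℝ) ∉ A) (hg : IsSwapOf g.1 g.1 A) :
    g ∈ transpositionGroup M hM :=
  mem_of_isSwapOf_self hM _ g refinable_true hA hAM hdisj hg
    fun _ _ _ _ hs => Subgroup.subset_closure ⟨_, _, hs⟩

/-- The transposition of a multirectangle with a disjoint translate of it is a product of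
rectangle transpositions. -/
theorem exists_translation_swap_mem {M : Set (Fin d → ℝ)} (hM : IsMultirectangle M)
    {A : Set (Fin d → ℝ)} (hA : IsMultirectangle A) (v : Fin d → ℝ) (hAM : A ⊆ M)
    (hvM : ∀ x ∈ A, x + v ∈ M) (hdisj : ∀ x ∈ A, x + v ∉ A) :
    ∃ s ∈ transpositionGroup M hM, ∀ x : M,
      ((x : Fin d → ℝ) ∈ A → (s.1 x : Fin d → ℝ) = x + v) ∧
      ((x : Fin d → ℝ) - v ∈ A → (s.1 x : Fin d → ℝ) = x - v) ∧
      ((x : Fin d → ℝ) ∉ A → (x : Fin d → ℝ) - v ∉ A → s.1 x = x) := by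
  obtain ⟨s, hs⟩ := exists_translation_swap hM hA v hAM hvM hdisj
  have hinv : ∀ x : M, (x : Fin d → ℝ) ∈ A → s.1 (s.1 x) = x := fun x hx => by
    have e := (hs x).1 hx
    apply Subtype.ext
    rw [(hs _).2.1 (by rwa [e, add_sub_cancel_right]), e, add_sub_cancel_right]
  refine ⟨s, mem_transpositionGroup_of_isSwapOf_self hM s hA hAM (fun x hx => ?_) fun x =>
    ⟨fun _ => rfl, fun hx => ?_, fun hx hx' => (hs x).2.2 hx fun h => hx' ?_⟩, hs⟩
  · rw [(hs x).1 hx]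
    exact hdisj x hx
  · have := hinv _ hx
    rwa [perm_apply_inv] at this
  · have e : s.1 ⟨_, hAM h⟩ = x := Subtype.ext (by rw [(hs _).1 h, sub_add_cancel])
    rw [← e, perm_inv_apply]
    exact h

theorem transpositionGroup_normal {M : Set (Fin d → ℝ)} (hM : IsMultirectangle M) :
    (transpositionGroup M hM).Normal := by
  refine ⟨fun t ht g => ?_⟩
  induction ht using Subgroup.closure_induction with
  | mem s hs =>
    obtain ⟨P, Q, hPQ⟩ := hs
    refine mem_transpositionGroup_of_isSwapOf_self hM _
      (isMultirectangle_img hM g.2 hPQ.1.isMultirectangle) (img_subset _ _) ?_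
      (hPQ.isSwapOf.conj g.1)
    intro x hx
    obtain ⟨y, rfl⟩ := g.1.surjective x
    rw [apply_mem_img] at hx
    have := hPQ.notMem_of_mem y hx
    simpa only [Subgroup.coe_mul, InvMemClass.coe_inv, Equiv.Perm.mul_apply, perm_inv_apply,
      apply_mem_img] using this
  | one => simp
  | mul s t _ _ hs ht =>
    have := Subgroup.mul_mem _ hs ht
    rwa [show g * s * g⁻¹ * (g * t * g⁻¹) = g * (s * t) * g⁻¹ by group] at this
  | inv s _ hs =>
    have := Subgroup.inv_mem _ hs
    rwa [show (g * s * g⁻¹)⁻¹ = g * s⁻¹ * g⁻¹ by group] at this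

/-! ### Packing a multirectangle into one of larger volume -/

/-- The index of the cell of the cubical grid of mesh `1 / n` that contains `x`. -/
noncomputable def cell (n : ℕ) (x : Fin d → ℝ) : Fin d → ℤ := fun i => ⌊n * x i⌋

/-- The vector with integral coordinates `w` in the grid of mesh `1 / n`. -/
noncomputable def gridVector (n : ℕ) (w : Fin d → ℤ) : Fin d → ℝ := fun i => w i / n

theorem cell_add_gridVector {n : ℕ} (hn : 0 < n) (x : Fin d → ℝ) (w : Fin d → ℤ) :
    cell n (x + gridVector n w) = cell n x + w := by
  ext i
  have hn' : (n : ℝ) ≠ 0 := by positivity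
  have : (n : ℝ) * (x i + w i / n) = n * x i + w i := by field_simp
  simp only [cell, gridVector, Pi.add_apply, this, Int.floor_add_intCast]

theorem cell_gridVector {n : ℕ} (hn : 0 < n) (z : Fin d → ℤ) : cell n (gridVector n z) = z := by
  have h : cell n (0 : Fin d → ℝ) = 0 := by
    ext i
    simp [cell]
  simpa [h] using cell_add_gridVector hn (0 : Fin d → ℝ) z

theorem isMultirectangle_cell {n : ℕ} (hn : 0 < n) (z : Fin d → ℤ) :
    IsMultirectangle {x : Fin d → ℝ | cell n x = z} := by
  have hn' : (0 : ℝ) < n := by positivity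
  refine IsRectangle.isMultirectangle
    ⟨fun i => z i / n, fun i => (z i + 1) / n, fun i =>
      (div_lt_div_iff_of_pos_right hn').2 (lt_add_one _), ?_⟩
  ext x
  rw [mem_box]
  simp only [Set.mem_ofPred_eq, cell, funext_iff, Int.floor_eq_iff, div_le_iff₀ hn',
    lt_div_iff₀ hn', mul_comm (n : ℝ)]

theorem exists_nat_forall_le_mul_sub {a b : Fin d → ℝ} (hab : ∀ i, a i < b i) (c : ℝ) :
    ∃ N : ℕ, ∀ i, c ≤ N * (b i - a i) := by
  choose N hN using fun i => Archimedean.arch c (sub_pos.2 (hab i))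
  refine ⟨∑ i, N i, fun i => (hN i).trans ?_⟩
  rw [nsmul_eq_mul]
  have h1 : N i ≤ ∑ i, N i :=
    Finset.single_le_sum (fun _ _ => Nat.zero_le _) (Finset.mem_univ i)
  have h2 := sub_pos.2 (hab i)
  gcongr

/-- For a fine grid, the number of the cells that meet `A` is at most `2 ^ d` times the volume
of `A` in units of a cell. -/
theorem IsMultirectangle.exists_card_cell_le {A : Set (Fin d → ℝ)} (hA : IsMultirectangle A) :
    ∃ N : ℕ, ∀ n ≥ N, ∃ O : Finset (Fin d → ℤ), (∀ x ∈ A, cell n x ∈ O) ∧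
      (O.card : ℝ) ≤ (2 * n) ^ d * volume.real A := by
  classical
  refine IsMultirectangle.induction refinable_true ?_ ?_ ?_ hA
  · exact ⟨0, fun n _ => ⟨∅, by simp⟩⟩
  · rintro _ ⟨a, b, hab, rfl⟩ -
    obtain ⟨N, hN⟩ := exists_nat_forall_le_mul_sub hab 2
    -- Each edge is at least `2` cells long, so it meets at most twice its length in cells.
    refine ⟨N, fun n hn => ⟨Fintype.piFinset fun i => Finset.Icc ⌊n * a i⌋ ⌊n * b i⌋, ?_, ?_⟩⟩
    · intro x hx
      rw [mem_box] at hx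
      simp only [Fintype.mem_piFinset, Finset.mem_Icc, cell]
      intro i
      have h1 := (hx i).1
      have h2 := (hx i).2.le
      constructor <;> gcongr
    · rw [Fintype.card_piFinset, measureReal_def, Real.volume_pi_Ico_toReal fun i => (hab i).le]
      have hd : (2 * (n : ℝ)) ^ d = ∏ _i : Fin d, (2 * (n : ℝ)) := by simp
      rw [hd, ← Finset.prod_mul_distrib, Nat.cast_prod]
      refine Finset.prod_le_prod (fun i _ => Nat.cast_nonneg _) fun i _ => ?_
      have h0 := sub_pos.2 (hab i)
      have h1 : 2 ≤ (n : ℝ) * (b i - a i) := (hN i).trans (by gcongr)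
      have h2 : ⌊n * a i⌋ ≤ ⌊n * b i⌋ := by
        have := (hab i).le
        gcongr
      have h3 : ((⌊n * b i⌋ + 1 - ⌊n * a i⌋ : ℤ).toNat : ℝ) = ⌊n * b i⌋ + 1 - ⌊n * a i⌋ := by
        rw [← Int.cast_natCast, Int.toNat_of_nonneg (by linarith)]
        push_cast
        ring
      rw [Int.card_Icc, h3]
      linarith [Int.floor_le ((n : ℝ) * b i), Int.lt_floor_add_one ((n : ℝ) * a i)]
  · rintro A B hA hB hAB ⟨N, hN⟩ ⟨N', hN'⟩
    refine ⟨max N N', fun n hn => ?_⟩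
    obtain ⟨O, hO, hOc⟩ := hN n (le_of_max_le_left hn)
    obtain ⟨O', hO', hOc'⟩ := hN' n (le_of_max_le_right hn)
    refine ⟨O ∪ O', ?_, ?_⟩
    · rintro x (hx | hx)
      · exact Finset.mem_union_left _ (hO x hx)
      · exact Finset.mem_union_right _ (hO' x hx)
    · have : ((O ∪ O').card : ℝ) ≤ O.card + O'.card := mod_cast Finset.card_union_le O O'
      rw [hA.volume_union hB hAB]
      linarith

/-- For a fine grid, the number of the cells contained in `A` is at least `2⁻¹ ^ d` times the
volume of `A` in units of a cell. -/
theorem IsMultirectangle.exists_le_card_cell {A : Set (Fin d → ℝ)} (hA : IsMultirectangle A) :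
    ∃ N : ℕ, ∀ n ≥ N, 0 < n → ∃ I : Finset (Fin d → ℤ), (∀ x, cell n x ∈ I → x ∈ A) ∧
      (n / 2) ^ d * volume.real A ≤ (I.card : ℝ) := by
  classical
  refine IsMultirectangle.induction refinable_true ?_ ?_ ?_ hA
  · exact ⟨0, fun n _ _ => ⟨∅, by simp⟩⟩
  · rintro _ ⟨a, b, hab, rfl⟩ -
    obtain ⟨N, hN⟩ := exists_nat_forall_le_mul_sub hab 4
    -- Each edge is at least `4` cells long, and at most `2` of them are lost at its ends.
    refine ⟨N, fun n hn hn0 =>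
      ⟨Fintype.piFinset fun i => Finset.Ico ⌈n * a i⌉ ⌊n * b i⌋, ?_, ?_⟩⟩
    · intro x hx
      have hn' : (0 : ℝ) < n := by positivity
      simp only [Fintype.mem_piFinset, Finset.mem_Ico, cell] at hx
      refine mem_box.2 fun i => ⟨le_of_mul_le_mul_left ?_ hn', lt_of_mul_lt_mul_left ?_ hn'.le⟩
      · exact (Int.le_ceil _).trans ((Int.cast_le.2 (hx i).1).trans (Int.floor_le _))
      · have h1 : (⌊n * x i⌋ : ℝ) + 1 ≤ ⌊n * b i⌋ := mod_cast (hx i).2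
        exact (Int.lt_floor_add_one _).trans_le (h1.trans (Int.floor_le _))
    · rw [Fintype.card_piFinset, measureReal_def, Real.volume_pi_Ico_toReal fun i => (hab i).le]
      have hd : ((n : ℝ) / 2) ^ d = ∏ _i : Fin d, ((n : ℝ) / 2) := by
        rw [Finset.prod_const, Finset.card_univ, Fintype.card_fin]
      rw [hd, ← Finset.prod_mul_distrib, Nat.cast_prod]
      refine Finset.prod_le_prod
        (fun i _ => mul_nonneg (by positivity) (sub_pos.2 (hab i)).le) fun i _ => ?_
      have h0 := sub_pos.2 (hab i)
      have h1 : 4 ≤ (n : ℝ) * (b i - a i) := (hN i).trans (by gcongr)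
      have h3 : ((⌊n * b i⌋ - ⌈n * a i⌉ : ℤ) : ℝ) ≤ ((⌊n * b i⌋ - ⌈n * a i⌉ : ℤ).toNat : ℝ) := by
        exact_mod_cast Int.self_le_toNat _
      rw [Int.card_Ico]
      push_cast at h3 ⊢
      linarith [Int.lt_floor_add_one ((n : ℝ) * b i), Int.ceil_lt_add_one ((n : ℝ) * a i)]
  · rintro A B hA hB hAB ⟨N, hN⟩ ⟨N', hN'⟩
    refine ⟨max N N', fun n hn hn0 => ?_⟩
    obtain ⟨I, hI, hIc⟩ := hN n (le_of_max_le_left hn) hn0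
    obtain ⟨I', hI', hIc'⟩ := hN' n (le_of_max_le_right hn) hn0
    have hdisj : Disjoint I I' := Finset.disjoint_left.2 fun z hz hz' => by
      rw [← cell_gridVector hn0 z] at hz hz'
      exact Set.disjoint_left.1 hAB (hI _ hz) (hI' _ hz')
    refine ⟨I ∪ I', fun x hx => (Finset.mem_union.1 hx).imp (hI x) (hI' x), ?_⟩
    rw [hA.volume_union hB hAB, Finset.card_union_of_disjoint hdisj]
    push_cast
    linarith

/-- Disjoint pieces `K i` of `A` can be simultaneously exchanged with disjoint translates of them
contained in `Z`, when `A` and `Z` are disjoint. -/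
theorem exists_mem_transpositionGroup_translate_family {M : Set (Fin d → ℝ)}
    (hM : IsMultirectangle M) {A Z : Set (Fin d → ℝ)} (hAM : A ⊆ M) (hZM : Z ⊆ M)
    (hAZ : Disjoint A Z) {ι : Type*} (s : Finset ι) (K : ι → Set (Fin d → ℝ)) (u : ι → Fin d → ℝ)
    (hK : ∀ i, IsMultirectangle (K i)) (hKA : ∀ i ∈ s, K i ⊆ A)
    (hKZ : ∀ i ∈ s, ∀ x ∈ K i, x + u i ∈ Z) (hKdisj : ∀ i j x, x ∈ K i → x ∈ K j → i = j)
    (hudisj : ∀ i ∈ s, ∀ j ∈ s, ∀ x ∈ K i, ∀ y ∈ K j, x + u i = y + u j → i = j) :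
    ∃ h ∈ transpositionGroup M hM,
      (∀ i ∈ s, ∀ x : M, (x : Fin d → ℝ) ∈ K i → (h.1 x : Fin d → ℝ) = x + u i) ∧
      ∀ x : M, (∀ i ∈ s, (x : Fin d → ℝ) ∉ K i ∧ (x : Fin d → ℝ) - u i ∉ K i) → h.1 x = x := by
  classical
  induction s using Finset.induction_on with
  | empty => exact ⟨1, Subgroup.one_mem _, by simp, by simp⟩
  | insert j s hj ih =>
    have hjs := Finset.mem_insert_self j s
    have hs : ∀ i ∈ s, i ∈ insert j s := fun i hi => Finset.mem_insert_of_mem hi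
    have hne : ∀ i ∈ s, i ≠ j := fun i hi h => hj (h ▸ hi)
    obtain ⟨h, hT, h1, h2⟩ := ih (fun i hi => hKA i (hs i hi)) (fun i hi => hKZ i (hs i hi))
      fun i hi k hk => hudisj i (hs i hi) k (hs k hk)
    have hd : ∀ x ∈ A, x ∉ Z := fun x hx => Set.disjoint_left.1 hAZ hx
    obtain ⟨t, htT, ht⟩ := exists_translation_swap_mem hM (hK j) (u j) ((hKA j hjs).trans hAM)
      (fun x hx => hZM (hKZ j hjs x hx))
      fun x hx hx' => hd _ (hKA j hjs hx') (hKZ j hjs x hx)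
    refine ⟨t * h, Subgroup.mul_mem _ htT hT, ?_, ?_⟩
    · intro i hi x hx
      rw [Subgroup.coe_mul, Equiv.Perm.mul_apply]
      obtain rfl | hi := Finset.mem_insert.1 hi
      · rw [h2 x, (ht x).1 hx]
        refine fun k hk => ⟨fun hxk => hne k hk (hKdisj _ _ _ hxk hx), fun hxk => ?_⟩
        have := hKZ k (hs k hk) _ hxk
        rw [sub_add_cancel] at this
        exact hd _ (hKA i hjs hx) this
      · have e := h1 i hi x hx
        rw [(ht (h.1 x)).2.2, e]
        · rw [e]
          exact fun h' => hd _ (hKA j hjs h') (hKZ i (hs i hi) x hx)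
        · rw [e]
          exact fun h' => hne i hi
            (hudisj i (hs i hi) j hjs x hx _ h' (sub_add_cancel _ _).symm)
    · intro x hx
      rw [Subgroup.coe_mul, Equiv.Perm.mul_apply, h2 x fun i hi => hx i (hs i hi),
        (ht x).2.2 (hx j hjs).1 (hx j hjs).2]

/-- If the volume of `Z` is large compared with that of `A`, some product of rectangle
transpositions moves `A` into `Z`. -/
theorem exists_mem_transpositionGroup_pack {M : Set (Fin d → ℝ)} (hM : IsMultirectangle M)
    {A Z : Set (Fin d → ℝ)} (hA : IsMultirectangle A) (hZ : IsMultirectangle Z) (hAM : A ⊆ M)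
    (hZM : Z ⊆ M) (hAZ : Disjoint A Z) (hvol : 4 ^ d * volume.real A ≤ volume.real Z) :
    ∃ h ∈ transpositionGroup M hM, (∀ x : M, (x : Fin d → ℝ) ∈ A → (h.1 x : Fin d → ℝ) ∈ Z) ∧
      ∀ x : M, (x : Fin d → ℝ) ∉ A → (x : Fin d → ℝ) ∉ Z → h.1 x = x := by
  obtain ⟨N, hN⟩ := hA.exists_card_cell_le
  obtain ⟨N', hN'⟩ := hZ.exists_le_card_cell
  obtain ⟨n, hn, hn', hn0⟩ : ∃ n, N ≤ n ∧ N' ≤ n ∧ 0 < n :=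
    ⟨N + N' + 1, by omega, by omega, by omega⟩
  obtain ⟨O, hO, hOc⟩ := hN n hn
  obtain ⟨I, hI, hIc⟩ := hN' n hn' hn0
  have hcard : O.card ≤ I.card := by
    have h : (2 * (n : ℝ)) ^ d * volume.real A ≤ (n / 2) ^ d * volume.real Z := by
      calc (2 * (n : ℝ)) ^ d * volume.real A = (n / 2) ^ d * (4 ^ d * volume.real A) := by
            rw [← mul_assoc, ← mul_pow]
            ring
        _ ≤ _ := by gcongr
    exact_mod_cast hOc.trans (h.trans hIc)
  obtain ⟨φ⟩ : Nonempty (O ↪ I) := Function.Embedding.nonempty_of_card_le (by simpa using hcard)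
  have hcell : ∀ (z : O) (x : Fin d → ℝ), cell n x = z →
      cell n (x + gridVector n ((φ z).1 - z.1)) = φ z := fun z x hx => by
    rw [cell_add_gridVector hn0, hx, add_sub_cancel]
  have hZ' : ∀ (z : O) (x : Fin d → ℝ), cell n x = z → x + gridVector n ((φ z).1 - z.1) ∈ Z :=
    fun z x hx => hI _ (by
      rw [hcell z x hx]
      exact (φ z).2)
  obtain ⟨h, hT, h1, h2⟩ := exists_mem_transpositionGroup_translate_family hM hAM hZM hAZ
    Finset.univ (fun z : O => A ∩ {x | cell n x = z}) (fun z => gridVector n ((φ z).1 - z.1))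
    (fun z => hA.inter (isMultirectangle_cell hn0 _)) (fun z _ => Set.inter_subset_left)
    (fun z _ x hx => hZ' z x hx.2) (fun z w x hx hy => Subtype.ext (hx.2.symm.trans hy.2))
    (fun z _ w _ x hx y hy hxy => φ.injective (Subtype.ext (by
      rw [← hcell z x hx.2, ← hcell w y hy.2, hxy])))
  refine ⟨h, hT, fun x hx => ?_, fun x hxA hxZ => h2 x fun z _ => ⟨fun h => hxA h.1, fun h => ?_⟩⟩
  · rw [h1 ⟨_, hO x hx⟩ (Finset.mem_univ _) x ⟨hx, rfl⟩]
    exact hZ' _ _ rfl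
  · have := hZ' z _ h.2
    rw [sub_add_cancel] at this
    exact hxZ this

/-! ### The derived subgroup is generated by the rectangle transpositions -/

theorem IsRectangle.volume_pos {K : Set (Fin d → ℝ)} (hK : IsRectangle K) :
    0 < volume.real K := by
  obtain ⟨a, b, hab, rfl⟩ := hK
  rw [measureReal_def, Real.volume_pi_Ico_toReal fun i => (hab i).le]
  exact Finset.prod_pos fun i _ => sub_pos.2 (hab i)

/-- Having volume at most a given positive number is a refinable property. In dimension zero it is
not, as a point then has volume one. -/
theorem refinable_volume_le (hd : 1 ≤ d) {c : ℝ} (hc : 0 < c) :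
    Refinable fun K : Set (Fin d → ℝ) => volume K ≤ ENNReal.ofReal c := by
  refine ⟨fun K L h hK => (measure_mono h).trans hK, fun A hA => ?_⟩
  obtain ⟨S, hS, hSp, hcov⟩ := (refinable_subset_cube (d := d) (lt_min hc one_pos)).cover A hA
  refine ⟨S, hS, fun B hB => ⟨(hSp B hB).1, ?_⟩, hcov⟩
  obtain ⟨p, hp⟩ := (hSp B hB).2
  refine (measure_mono hp).trans ?_
  rw [cube, Real.volume_pi_Ico]
  simp only [add_sub_cancel_left, Finset.prod_const, Finset.card_univ, Fintype.card_fin]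
  rw [← ENNReal.ofReal_pow (lt_min hc one_pos).le]
  refine ENNReal.ofReal_le_ofReal ?_
  exact (pow_le_of_le_one (lt_min hc one_pos).le (min_le_right _ _) (by omega)).trans
    (min_le_left _ _)

theorem volume_real_mono {A B : Set (Fin d → ℝ)} (hB : IsMultirectangle B) (h : A ⊆ B) :
    volume.real A ≤ volume.real B :=
  measureReal_mono h hB.volume_ne_top

/-- Up to a product of rectangle transpositions, every rectangle exchange is supported in a
prescribed rectangle `C`. The complement of `C` is treated piece by piece, each piece having small
volume compared with `C`, so that there is always enough free room to park the piece before it is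
sent to its destination. -/
theorem exists_mem_transpositionGroup_eq_off {M : Set (Fin d → ℝ)} (hM : IsMultirectangle M)
    (hd : 1 ≤ d) (f : recGroup M hM) {C : Set (Fin d → ℝ)} (hC : IsRectangle C) (hCM : C ⊆ M) :
    ∃ t ∈ transpositionGroup M hM, ∀ x : M, (x : Fin d → ℝ) ∉ C → t.1 x = f.1 x := by
  have hCm := hC.isMultirectangle
  have key : ∀ X, IsMultirectangle X → X ⊆ M \ C → ∀ Y, IsMultirectangle Y → Y ⊆ M \ C →
      Disjoint Y X → ∀ t ∈ transpositionGroup M hM,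
      (∀ x : M, (x : Fin d → ℝ) ∈ Y → t.1 x = f.1 x) → ∃ t' ∈ transpositionGroup M hM,
        ∀ x : M, (x : Fin d → ℝ) ∈ Y ∪ X → t'.1 x = f.1 x := by
    intro X hX
    refine IsMultirectangle.induction (refinable_volume_le hd
      (c := volume.real C / (2 * 4 ^ d)) (div_pos hC.volume_pos (by positivity))) ?_ ?_ ?_ hX
    · intro _ Y _ _ _ t ht h
      exact ⟨t, ht, by simpa using h⟩
    · intro X hX hvol hXM Y hY hYM hYX t ht hty
      have hX := hX.isMultirectangle
      replace hXM := Set.subset_sdiff.1 hXM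
      replace hYM := Set.subset_sdiff.1 hYM
      have hvol : volume.real X ≤ volume.real C / (2 * 4 ^ d) :=
        ENNReal.toReal_le_of_le_ofReal (by positivity) hvol
      let A := img t.1 X
      let B := img f.1 X
      let Z := M \ (img f.1 Y ∪ (A ∪ B))
      have hA : IsMultirectangle A := isMultirectangle_img hM t.2 hX
      have hB : IsMultirectangle B := isMultirectangle_img hM f.2 hX
      have hfY : IsMultirectangle (img f.1 Y) := isMultirectangle_img hM f.2 hY
      have hZ : IsMultirectangle Z := hM.diff (hfY.union (hA.union hB))
      have hvA : volume.real A = volume.real X := hM.volume_img t.2 hX hXM.1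
      have hvB : volume.real B = volume.real X := hM.volume_img f.2 hX hXM.1
      have hvY : volume.real (img f.1 Y) = volume.real Y := hM.volume_img f.2 hY hYM.1
      have hvZ : volume.real C - volume.real X ≤ volume.real Z := by
        have h1 : volume.real M ≤ volume.real Z + (volume.real Y + (volume.real X +
            volume.real X)) := by
          rw [← hvY]
          nth_rw 2 [← hvB]
          rw [← hvA]
          refine (volume_real_mono (hZ.union (hfY.union (hA.union hB))) ?_).trans ?_
          · exact fun x hx => or_iff_not_imp_right.2 fun h => ⟨hx, h⟩
          · refine (measureReal_union_le _ _).trans ?_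
            gcongr
            refine (measureReal_union_le _ _).trans ?_
            gcongr
            exact measureReal_union_le _ _
        have h2 : volume.real Y + volume.real X + volume.real C ≤ volume.real M := by
          rw [← hY.volume_union hX hYX, ← (hY.union hX).volume_union hCm
            (Set.disjoint_union_left.2 ⟨hYM.2, hXM.2⟩)]
          exact volume_real_mono hM (Set.union_subset (Set.union_subset hYM.1 hXM.1) hCM)
        linarith
      have hAZ : Disjoint A Z := Set.disjoint_left.2 fun x hx hx' => hx'.2 (Or.inr (Or.inl hx))
      have hpack : 4 ^ d * volume.real A ≤ volume.real Z := by
        refine le_trans ?_ hvZ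
        have h4 : (1 : ℝ) ≤ 4 ^ d := one_le_pow₀ (by norm_num)
        have h0 : 0 ≤ volume.real X := measureReal_nonneg
        rw [le_div_iff₀ (by positivity)] at hvol
        rw [hvA]
        nlinarith
      obtain ⟨h, hT, hAh, hfix⟩ := exists_mem_transpositionGroup_pack hM hA hZ (img_subset _ _)
        Set.sdiff_subset hAZ hpack
      have hWZ : img h.1 A ⊆ Z := by
        rintro _ ⟨x, hx, rfl⟩
        exact hAh x hx
      -- `W = h A` is disjoint from the destination `B` of `X`, hence can be swapped with it.
      obtain ⟨s, hsT, hs⟩ := exists_swap_mem_transpositionGroup hM (f * t⁻¹ * h⁻¹)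
        (isMultirectangle_img hM h.2 hA) (img_subset _ _) (by
          rintro x hx hx'
          refine (hWZ hx').2 (Or.inr (Or.inr ?_))
          rw [mem_img_iff, mem_img_iff] at hx
          simp only [Subgroup.coe_mul, InvMemClass.coe_inv, Equiv.Perm.mul_apply]
          exact apply_mem_img.2 hx)
      refine ⟨s * h * t, mul_mem (mul_mem hsT hT) ht, ?_⟩
      have hYA : ∀ x : M, (x : Fin d → ℝ) ∈ Y → (x : Fin d → ℝ) ∉ X := fun x hx =>
        Set.disjoint_left.1 hYX hx
      rintro x (hx | hx)
      · have e := hty x hx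
        have h1 : (f.1 x : Fin d → ℝ) ∉ A := by
          rw [← e, apply_mem_img]
          exact hYA x hx
        have h2 : (f.1 x : Fin d → ℝ) ∉ Z := fun h => h.2 (Or.inl (apply_mem_img.2 hx))
        simp only [Subgroup.coe_mul, Equiv.Perm.mul_apply]
        rw [e, hfix _ h1 h2]
        refine (hs _).2.2 (fun h => h2 (hWZ h)) ?_
        simp only [mul_inv_rev, Subgroup.coe_mul, InvMemClass.coe_inv, inv_inv,
          Equiv.Perm.mul_apply, perm_inv_apply, apply_mem_img, A]
        exact hYA x hx
      · simp only [Subgroup.coe_mul, Equiv.Perm.mul_apply]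
        rw [(hs _).1 (apply_mem_img.2 (apply_mem_img.2 hx))]
        simp only [Subgroup.coe_mul, InvMemClass.coe_inv, Equiv.Perm.mul_apply, perm_inv_apply]
    · intro X X' hX hX' hXX' ih ih' hXM Y hY hYM hYX t ht hty
      rw [Set.union_subset_iff] at hXM
      rw [Set.disjoint_union_right] at hYX
      obtain ⟨t', ht', h'⟩ := ih hXM.1 Y hY hYM hYX.1 t ht hty
      obtain ⟨t'', ht'', h''⟩ := ih' hXM.2 (Y ∪ X) (hY.union hX) (Set.union_subset hYM hXM.1)
        (Set.disjoint_union_left.2 ⟨hYX.2, hXX'⟩) t' ht' h'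
      exact ⟨t'', ht'', by rwa [← Set.union_assoc]⟩
  obtain ⟨t, ht, h⟩ := key (M \ C) (hM.diff hCm) subset_rfl ∅ isMultirectangle_empty
    (Set.empty_subset _) (Set.empty_disjoint _) 1 (Subgroup.one_mem _) (by simp)
  exact ⟨t, ht, fun x hx => h x (Or.inr ⟨x.2, hx⟩)⟩

/-- A rectangle is cut into two halves, translates of each other. -/
theorem IsRectangle.exists_half (hd : 1 ≤ d) {P : Set (Fin d → ℝ)} (hP : IsRectangle P) :
    ∃ (H : Set (Fin d → ℝ)) (u : Fin d → ℝ), IsRectangle H ∧ H ⊆ P ∧ (∀ x ∈ H, x + u ∈ P) ∧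
      (∀ x ∈ H, x + u ∉ H) ∧ ∀ x ∈ P, x ∈ H ∨ x - u ∈ H := by
  obtain ⟨a, b, hab, rfl⟩ := hP
  let o : Fin d := ⟨0, hd⟩
  have hH : ∀ x, x ∈ Set.pi Set.univ
      (fun i => Set.Ico (a i) (Function.update b o ((a o + b o) / 2) i)) ↔
      (∀ i, a i ≤ x i ∧ x i < b i) ∧ x o < (a o + b o) / 2 := by
    intro x
    rw [mem_box]
    have := hab o
    constructor
    · intro h
      have ho := h o
      rw [Function.update_self] at ho
      refine ⟨fun i => ?_, ho.2⟩
      by_cases hi : i = o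
      · subst hi
        exact ⟨ho.1, by linarith⟩
      · have := h i
        rwa [Function.update_of_ne hi] at this
    · rintro ⟨h1, h2⟩ i
      by_cases hi : i = o
      · subst hi
        rw [Function.update_self]
        exact ⟨(h1 o).1, h2⟩
      · rw [Function.update_of_ne hi]
        exact h1 i
  have hu : ∀ i, Pi.single (M := fun _ => ℝ) o ((b o - a o) / 2) i =
      if i = o then (b o - a o) / 2 else 0 := fun i => by rw [Pi.single_apply]
  have ho := hab o
  refine ⟨_, Pi.single o ((b o - a o) / 2),
    ⟨a, Function.update b o ((a o + b o) / 2), ?_, rfl⟩, ?_, ?_, ?_, ?_⟩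
  · intro i
    by_cases hi : i = o
    · subst hi
      rw [Function.update_self]
      linarith
    · rw [Function.update_of_ne hi]
      exact hab i
  · exact fun x hx => mem_box.2 ((hH x).1 hx).1
  · intro x hx
    rw [hH] at hx
    refine mem_box.2 fun i => ?_
    have := hx.1 i
    rw [Pi.add_apply, hu]
    split_ifs with h
    · subst h
      constructor <;> linarith [hx.2]
    · simpa using this
  · intro x hx hx'
    rw [hH] at hx hx'
    have h1 := hx'.2
    rw [Pi.add_apply, hu, if_pos rfl] at h1
    linarith [(hx.1 o).1]
  · intro x hx
    rw [mem_box] at hx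
    rw [hH, hH]
    by_cases h : x o < (a o + b o) / 2
    · exact Or.inl ⟨hx, h⟩
    · refine Or.inr ⟨fun i => ?_, ?_⟩
      · rw [Pi.sub_apply, hu]
        split_ifs with hi
        · subst hi
          constructor <;> linarith [(hx o).2]
        · simpa using hx i
      · rw [Pi.sub_apply, hu, if_pos rfl]
        linarith [(hx o).2]

/-- Every rectangle transposition is a commutator of products of rectangle transpositions with
the same support: the exchange of the first halves of `P` and `Q` is conjugate to the exchange of
the second halves. -/
theorem IsRectTransposition.exists_commutator_eq {M : Set (Fin d → ℝ)} {hM : IsMultirectangle M}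
    (hd : 1 ≤ d) {τ : recGroup M hM} {P Q : Set (Fin d → ℝ)}
    (hτ : IsRectTransposition M τ.1 P Q) :
    ∃ α ∈ transpositionGroup M hM, ∃ g ∈ transpositionGroup M hM, τ = α * g * α⁻¹ * g⁻¹ ∧
      ∀ x : M, (x : Fin d → ℝ) ∉ P → (x : Fin d → ℝ) ∉ Q → α.1 x = x ∧ g.1 x = x := by
  obtain ⟨hP, hQ, hPM, hQM, hPQ, v, rfl, hv⟩ := hτ
  obtain ⟨H, u, hH, hHP, hHu, hHH, hHsplit⟩ := hP.exists_half hd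
  have hQmem : ∀ x, x + v ∈ (fun x => x + v) '' P ↔ x ∈ P := fun x => by simp
  have hPQ' : ∀ x ∈ P, x + v ∉ P := fun x hx hx' =>
    Set.disjoint_left.1 hPQ hx' ((hQmem x).2 hx)
  have hPv : ∀ x ∈ P, x - v ∉ P := fun x hx hx' => hPQ' _ hx' (by rwa [sub_add_cancel])
  have hQM' : ∀ x ∈ P, x + v ∈ M := fun x hx => hQM ((hQmem x).2 hx)
  obtain ⟨α, hαT, hα⟩ := exists_translation_swap_mem hM hH.isMultirectangle v (hHP.trans hPM)
    (fun x hx => hQM' x (hHP hx)) fun x hx hx' => hPQ' x (hHP hx) (hHP hx')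
  have hHv : ∀ x, x + v ∈ (fun x => x + v) '' H ↔ x ∈ H := fun x => by simp
  have hHv' : (fun x => x + v) '' H ⊆ (fun x => x + v) '' P := Set.image_mono hHP
  obtain ⟨g, hgT, hg⟩ := exists_translation_swap_mem hM
    (hH.isMultirectangle.union (hH.isMultirectangle.image_add v)) u
    (Set.union_subset (hHP.trans hPM) (hHv'.trans hQM)) (by
      rintro _ (hx | ⟨x, hx, rfl⟩)
      · exact hPM (hHu _ hx)
      · dsimp only
        rw [add_right_comm]
        exact hQM' _ (hHu x hx)) (by
      rintro _ (hx | ⟨x, hx, rfl⟩)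
      · rintro (h | h)
        · exact hHH _ hx h
        · exact Set.disjoint_left.1 hPQ (hHu _ hx) (hHv' h)
      · dsimp only
        rw [add_right_comm]
        rintro (h | h)
        · exact hPQ' _ (hHu x hx) (hHP h)
        · exact hHH x hx ((hHv _).1 h))
  have hfix : ∀ x : M, (x : Fin d → ℝ) ∉ P → (x : Fin d → ℝ) ∉ (fun x => x + v) '' P →
      α.1 x = x ∧ g.1 x = x := by
    intro x hxP hxQ
    refine ⟨(hα x).2.2 (fun h => hxP (hHP h)) fun h => hxQ ⟨_, hHP h, sub_add_cancel _ _⟩,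
      (hg x).2.2 ?_ ?_⟩
    · rintro (h | h)
      · exact hxP (hHP h)
      · exact hxQ (hHv' h)
    · rintro (h | ⟨y, hy, hyx⟩)
      · exact hxP (by simpa only [sub_add_cancel] using hHu _ h)
      · exact hxQ ⟨y + u, hHu y hy, by
          dsimp only at hyx ⊢
          rw [add_right_comm, hyx, sub_add_cancel]⟩
  refine ⟨α, hαT, g, hgT, ?_, hfix⟩
  · suffices h : τ * (g * α) = α * g by
      rw [← h]
      group
    apply Subtype.ext
    ext1 x
    simp only [Subgroup.coe_mul, Equiv.Perm.mul_apply]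
    -- The three maps on the four points `w`, `w + u`, `w + v`, `w + u + v`, for `w` in `H`.
    have key : ∀ w ∈ H, ∃ p p' q q' : M, (p : Fin d → ℝ) = w ∧ (p' : Fin d → ℝ) = w + u ∧
        (q : Fin d → ℝ) = w + v ∧ (q' : Fin d → ℝ) = w + u + v ∧
        (α.1 p = q ∧ α.1 q = p ∧ α.1 p' = p' ∧ α.1 q' = q') ∧
        (g.1 p = p' ∧ g.1 p' = p ∧ g.1 q = q' ∧ g.1 q' = q) ∧
        (τ.1 p = q ∧ τ.1 q = p ∧ τ.1 p' = q' ∧ τ.1 q' = p') := by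
      intro w hw
      have hwP := hHP hw
      have hwu := hHu w hw
      refine ⟨⟨w, hPM hwP⟩, ⟨w + u, hPM hwu⟩, ⟨w + v, hQM' w hwP⟩, ⟨w + u + v, hQM' _ hwu⟩,
        rfl, rfl, rfl, rfl, ⟨?_, ?_, ?_, ?_⟩, ⟨?_, ?_, ?_, ?_⟩, ⟨?_, ?_, ?_, ?_⟩⟩
      · exact Subtype.ext ((hα _).1 hw)
      · refine Subtype.ext (((hα _).2.1 ?_).trans ?_) <;> simp [hw]
      · exact (hα _).2.2 (hHH w hw) fun h => hPv _ hwu (hHP h)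
      · refine (hα _).2.2 (fun h => hPQ' _ hwu (hHP h)) ?_
        simpa using hHH w hw
      · exact Subtype.ext ((hg _).1 (Or.inl hw))
      · refine Subtype.ext (((hg _).2.1 (Or.inl ?_)).trans ?_) <;> simp [hw]
      · exact Subtype.ext (((hg _).1 (Or.inr ((hHv w).2 hw))).trans (add_right_comm w v u))
      · have e : w + u + v - u = w + v := by abel
        refine Subtype.ext (((hg _).2.1 (Or.inr ?_)).trans e)
        dsimp only
        rw [e]
        exact (hHv w).2 hw
      · exact Subtype.ext ((hv _).1 hwP)
      · exact Subtype.ext (((hv _).2.1 ((hQmem w).2 hwP)).trans (add_sub_cancel_right w v))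
      · exact Subtype.ext ((hv _).1 hwu)
      · exact Subtype.ext (((hv _).2.1 ((hQmem _).2 hwu)).trans (add_sub_cancel_right _ v))
    by_cases hxP : (x : Fin d → ℝ) ∈ P
    · rcases hHsplit x hxP with h | h
      · obtain ⟨p, p', q, q', hp, hp', hq, hq', h1, h2, h3⟩ := key _ h
        obtain rfl : p = x := Subtype.ext hp
        simp only [h1, h2, h3]
      · obtain ⟨p, p', q, q', hp, hp', hq, hq', h1, h2, h3⟩ := key _ h
        obtain rfl : p' = x := Subtype.ext (by rw [hp', sub_add_cancel])
        simp only [h1, h2, h3]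
    by_cases hxQ : (x : Fin d → ℝ) ∈ (fun x => x + v) '' P
    · obtain ⟨y, hyP, hyx⟩ := hxQ
      dsimp only at hyx
      rcases hHsplit y hyP with h | h
      · obtain ⟨p, p', q, q', hp, hp', hq, hq', h1, h2, h3⟩ := key _ h
        obtain rfl : q = x := Subtype.ext (by rw [hq, hyx])
        simp only [h1, h2, h3]
      · obtain ⟨p, p', q, q', hp, hp', hq, hq', h1, h2, h3⟩ := key _ h
        obtain rfl : q' = x := Subtype.ext (by rw [hq', sub_add_cancel, hyx])
        simp only [h1, h2, h3]
    · rw [(hfix x hxP hxQ).1, (hfix x hxP hxQ).2, (hfix x hxP hxQ).1, (hv x).2.2 hxP hxQ]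

theorem IsMultirectangle.exists_rectangle_subset {A : Set (Fin d → ℝ)} (hA : IsMultirectangle A)
    (hne : A.Nonempty) : ∃ K ⊆ A, IsRectangle K := by
  obtain ⟨P, -, hPr, rfl⟩ := hA
  obtain ⟨x, K, hK, -⟩ := hne
  exact ⟨K, Set.subset_sUnion_of_mem hK, hPr K hK⟩

/-- Modulo rectangle transpositions, any two rectangle exchanges have representatives with
disjoint supports, hence they commute. -/
theorem commutator_le_transpositionGroup {M : Set (Fin d → ℝ)} (hM : IsMultirectangle M)
    (hd : 1 ≤ d) (hne : M.Nonempty) :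
    commutator (recGroup M hM) ≤ transpositionGroup M hM := by
  have hN := transpositionGroup_normal hM
  obtain ⟨K, hKM, hK⟩ := hM.exists_rectangle_subset hne
  obtain ⟨C, u, hC, hCK, hCu, hCC, -⟩ := hK.exists_half hd
  rw [commutator_def, Subgroup.commutator_le]
  rintro f - g -
  obtain ⟨s, hs, hsf⟩ := exists_mem_transpositionGroup_eq_off hM hd f hC (hCK.trans hKM)
  obtain ⟨t, ht, htg⟩ := exists_mem_transpositionGroup_eq_off hM hd g (hC.image_add u)
    (by
      rintro _ ⟨x, hx, rfl⟩
      exact hKM (hCu x hx))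
  have hcomm : Commute (s⁻¹ * f) (t⁻¹ * g) := by
    refine Subtype.ext (Equiv.Perm.Disjoint.commute fun x => ?_)
    by_cases hx : (x : Fin d → ℝ) ∈ C
    · right
      rw [Subgroup.coe_mul, Equiv.Perm.mul_apply, ← htg x, InvMemClass.coe_inv, perm_inv_apply]
      rintro ⟨y, hy, hyx⟩
      dsimp only at hyx
      exact hCC y hy (hyx ▸ hx)
    · left
      rw [Subgroup.coe_mul, Equiv.Perm.mul_apply, ← hsf x hx, InvMemClass.coe_inv, perm_inv_apply]
  -- In the quotient, `f` and `g` are the classes of the commuting `s⁻¹ * f` and `t⁻¹ * g`.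
  rw [← QuotientGroup.eq_one_iff]
  have h1 : ((s⁻¹ * f : recGroup M hM) : recGroup M hM ⧸ transpositionGroup M hM) = f := by
    rw [QuotientGroup.mk_mul, QuotientGroup.mk_inv, (QuotientGroup.eq_one_iff s).2 hs, inv_one,
      one_mul]
  have h2 : ((t⁻¹ * g : recGroup M hM) : recGroup M hM ⧸ transpositionGroup M hM) = g := by
    rw [QuotientGroup.mk_mul, QuotientGroup.mk_inv, (QuotientGroup.eq_one_iff t).2 ht, inv_one,
      one_mul]
  have h3 : (f : recGroup M hM ⧸ transpositionGroup M hM) * g = g * f := by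
    rw [← h1, ← h2, ← QuotientGroup.mk_mul, hcomm.eq, QuotientGroup.mk_mul]
  rw [commutatorElement_def, QuotientGroup.mk_mul, QuotientGroup.mk_mul, QuotientGroup.mk_mul,
    QuotientGroup.mk_inv, QuotientGroup.mk_inv, h3]
  group

theorem transpositionGroup_eq_commutator {M : Set (Fin d → ℝ)} (hM : IsMultirectangle M)
    (hd : 1 ≤ d) (hne : M.Nonempty) :
    transpositionGroup M hM = commutator (recGroup M hM) := by
  refine le_antisymm ((Subgroup.closure_le _).2 ?_) (commutator_le_transpositionGroup hM hd hne)
  rintro τ ⟨P, Q, hτ⟩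
  obtain ⟨α, -, g, -, rfl, -⟩ := hτ.exists_commutator_eq hd
  exact Subgroup.commutator_mem_commutator (Subgroup.mem_top α) (Subgroup.mem_top g)

/-! ### Generation by small transpositions -/

/-- Having image by `g` inside one member of a given partition is a refinable property. -/
theorem refinable_img_subset {M : Set (Fin d → ℝ)} (hM : IsMultirectangle M) (hne : M.Nonempty)
    (g : recGroup M hM) {Q : Set (Set (Fin d → ℝ))} (hQ : IsRectPartition Q M) :
    Refinable fun K => ∃ L ∈ Q, img g.1 K ⊆ L := by
  refine ⟨fun K K' h ⟨L, hL, hKL⟩ => ⟨L, hL, ?_⟩, fun A hA => ?_⟩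
  · rintro _ ⟨x, hx, rfl⟩
    exact hKL ⟨x, h hx, rfl⟩
  refine ⟨insert (A \ M) (img (g⁻¹).1 '' Q), (hQ.1.image _).insert _, ?_, fun x hx => ?_⟩
  · rintro B (rfl | ⟨L, hL, rfl⟩)
    · obtain ⟨x, hx⟩ := hne
      obtain ⟨L, hL, -⟩ := hQ.exists_mem hx
      refine ⟨hA.diff hM, L, hL, ?_⟩
      rintro _ ⟨y, hy, -⟩
      exact absurd y.2 hy.2
    · refine ⟨isMultirectangle_img hM (g⁻¹).2 (hQ.2.1 L hL).isMultirectangle, L, hL, ?_⟩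
      rintro _ ⟨y, hy, rfl⟩
      rw [mem_img_iff, InvMemClass.coe_inv, inv_inv] at hy
      exact hy
  · by_cases hxM : x ∈ M
    · obtain ⟨L, hL, hxL⟩ := hQ.exists_mem (g.1 ⟨x, hxM⟩).2
      refine ⟨_, Set.mem_insert_of_mem _ ⟨L, hL, rfl⟩, g.1 ⟨x, hxM⟩, hxL, ?_⟩
      rw [InvMemClass.coe_inv, perm_inv_apply]
    · exact ⟨A \ M, Set.mem_insert _ _, hx, hxM⟩

/-- A subset of a rectangle `L` contained in a small cube is contained in a cube of the same side
inside `L`. -/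
theorem IsRectangle.eventually_exists_cube {L : Set (Fin d → ℝ)} (hL : IsRectangle L) :
    ∀ᶠ ε in nhdsWithin (0 : ℝ) (Set.Ioi 0), ∀ K ⊆ L, (∃ c, K ⊆ cube c ε) →
      ∃ c, K ⊆ cube c ε ∧ cube c ε ⊆ L := by
  obtain ⟨a, b, hab, rfl⟩ := hL
  have h : ∀ᶠ ε in nhdsWithin (0 : ℝ) (Set.Ioi 0), ∀ i, ε < b i - a i := by
    rw [Filter.eventually_all]
    exact fun i => nhdsWithin_le_nhds (eventually_lt_nhds (sub_pos.2 (hab i)))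
  filter_upwards [h] with ε hε K hK
  rintro ⟨c, hc⟩
  -- The given cube is pushed back into `L`.
  refine ⟨fun i => max (a i) (min (c i) (b i - ε)), fun x hx => ?_, fun x hx => ?_⟩
  · have h1 := mem_box.1 (hK hx)
    have h2 := mem_box.1 (hc hx)
    refine mem_box.2 fun i => ?_
    have h1 := h1 i
    have h2 := h2 i
    grind
  · rw [cube, mem_box] at hx
    refine mem_box.2 fun i => ?_
    have h1 := hx i
    have h2 := hε i
    grind

theorem exists_closure_smallTranspositions_eq {M : Set (Fin d → ℝ)} (hM : IsMultirectangle M)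
    (hne : M.Nonempty) : ∃ ε₀ : ℝ, 0 < ε₀ ∧ ∀ ε : ℝ, 0 < ε → ε ≤ ε₀ →
      Subgroup.closure (smallTranspositions M hM ε) = transpositionGroup M hM := by
  obtain ⟨R, hR⟩ := hM.exists_partition
  have hev := (Filter.eventually_all_finite hR.1).2 fun L hL => (hR.2.1 L hL).eventually_exists_cube
  obtain ⟨ε₀, hε₀, h⟩ := mem_nhdsGT_iff_exists_Ioc_subset.1 hev
  refine ⟨ε₀, hε₀, fun ε hε hε' => le_antisymm ?_ ?_⟩
  · exact Subgroup.closure_mono fun τ ⟨P, Q, hτ, _⟩ => ⟨P, Q, hτ⟩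
  refine (Subgroup.closure_le _).2 ?_
  rintro τ ⟨P, Q, hτ⟩
  refine mem_of_isSwapOf_self hM _ τ ((refinable_subset_cube hε).and
    ((refinable_img_subset hM hne 1 hR).and (refinable_img_subset hM hne τ hR)))
    hτ.1.isMultirectangle hτ.2.2.1 hτ.notMem_of_mem hτ.isSwapOf ?_
  rintro K hKP ⟨⟨c, hc⟩, ⟨L, hL, hKL⟩, ⟨L', hL', hKL'⟩⟩ s hs
  refine Subgroup.subset_closure ⟨K, img τ.1 K, hs, ?_, ?_⟩
  · obtain ⟨c', hc', hcL⟩ := h ⟨hε, hε'⟩ L hL K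
      (fun x hx => hKL ⟨⟨x, hs.2.2.1 hx⟩, hx, rfl⟩) ⟨c, hc⟩
    exact ⟨c', hc', hcL.trans (hR.subset hL)⟩
  · obtain ⟨c', hc', hcL⟩ := h ⟨hε, hε'⟩ L' hL' _ hKL' (by
      obtain ⟨-, -, -, -, -, v, hv, -⟩ := hs
      refine ⟨c + v, ?_⟩
      rw [hv]
      rintro _ ⟨x, hx, rfl⟩
      have := mem_box.1 (hc hx)
      refine mem_box.2 fun i => ?_
      have := this i
      simp only [Pi.add_apply]
      constructor <;> linarith)
    exact ⟨c', hc', hcL.trans (hR.subset hL')⟩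

/-! ### Normal generation and simplicity -/

/-- A subgroup normalized by the transposition group contains it as soon as it contains the
transpositions inside some nonempty multirectangle `U`: small rectangles can be moved into `U`. -/
theorem transpositionGroup_le_of_transpositionsIn {M : Set (Fin d → ℝ)} (hM : IsMultirectangle M)
    (hd : 1 ≤ d) {U : Set (Fin d → ℝ)} (hU : IsMultirectangle U) (hUne : U.Nonempty) (hUM : U ⊆ M)
    (N : Subgroup (recGroup M hM))
    (hN : ∀ t ∈ transpositionGroup M hM, ∀ n ∈ N, t * n * t⁻¹ ∈ N)
    (hUN : transpositionsIn M hM U ⊆ N) : transpositionGroup M hM ≤ N := by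
  obtain ⟨C, hCU, hC⟩ := hU.exists_rectangle_subset hUne
  have hCm := hC.isMultirectangle
  have hCpos := hC.volume_pos
  refine (Subgroup.closure_le _).2 ?_
  rintro τ ⟨P, Q, hτ⟩
  refine mem_of_isSwapOf_self hM N τ (refinable_volume_le hd
    (c := volume.real C / (4 * 4 ^ d)) (div_pos hCpos (by positivity)))
    hτ.1.isMultirectangle hτ.2.2.1 hτ.notMem_of_mem hτ.isSwapOf ?_
  intro K _ hvol s hs
  have hvol : volume.real K ≤ volume.real C / (4 * 4 ^ d) :=
    ENNReal.toReal_le_of_le_ofReal (by positivity) hvol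
  have hKm := hs.1.isMultirectangle
  have hK'm := hs.2.1.isMultirectangle
  have hKK' := hKm.union hK'm
  have hKK'M : K ∪ img τ.1 K ⊆ M := Set.union_subset hs.2.2.1 hs.2.2.2.1
  have hvK' : volume.real (img τ.1 K) = volume.real K := hM.volume_img τ.2 hKm hs.2.2.1
  have hvKK' : volume.real (K ∪ img τ.1 K) ≤ 2 * volume.real K :=
    (measureReal_union_le _ _).trans (by linarith)
  have hpack : 4 ^ d * volume.real ((K ∪ img τ.1 K) \ C) ≤
      volume.real (C \ (K ∪ img τ.1 K)) := by
    have h1 : volume.real ((K ∪ img τ.1 K) \ C) ≤ 2 * volume.real K :=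
      (volume_real_mono hKK' Set.sdiff_subset).trans hvKK'
    have h2 : volume.real C ≤ volume.real (C \ (K ∪ img τ.1 K)) + 2 * volume.real K := by
      refine (volume_real_mono ((hCm.diff hKK').union hKK') ?_).trans
        ((measureReal_union_le _ _).trans (by linarith))
      rw [Set.sdiff_union_self]
      exact Set.subset_union_left
    have h4 : (1 : ℝ) ≤ 4 ^ d := one_le_pow₀ (by norm_num)
    have h0 : 0 ≤ volume.real K := measureReal_nonneg
    rw [le_div_iff₀ (by positivity)] at hvol
    nlinarith
  obtain ⟨h, hT, hmove, hfix⟩ := exists_mem_transpositionGroup_pack hM (hKK'.diff hCm)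
    (hCm.diff hKK') (Set.sdiff_subset.trans hKK'M) (Set.sdiff_subset.trans (hCU.trans hUM))
    (Set.disjoint_left.2 fun x hx hx' => hx'.2 hx.1) hpack
  have hC' : ∀ x : M, (x : Fin d → ℝ) ∈ K ∪ img τ.1 K → (h.1 x : Fin d → ℝ) ∈ C := by
    intro x hx
    by_cases hxC : (x : Fin d → ℝ) ∈ C
    · rw [hfix x (fun h => h.2 hxC) fun h => h.2 hx]
      exact hxC
    · exact (hmove x ⟨hx, hxC⟩).1
  -- The conjugate of `s` by `h` exchanges two multirectangles contained in `C`.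
  have hs' : h * s * h⁻¹ ∈ N := by
    refine mem_of_isSwapOf_self hM N (h * s * h⁻¹) refinable_true
      (isMultirectangle_img hM h.2 hKm) (img_subset _ _) ?_ (hs.isSwapOf.conj h.1) ?_
    · intro x hx
      obtain ⟨y, rfl⟩ := h.1.surjective x
      rw [apply_mem_img] at hx
      have := hs.notMem_of_mem y hx
      simpa only [Subgroup.coe_mul, InvMemClass.coe_inv, Equiv.Perm.mul_apply, perm_inv_apply,
        apply_mem_img] using this
    · intro L hL _ r hr
      refine hUN ⟨L, _, hr, fun y hy => hCU ?_, ?_⟩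
      · obtain ⟨x, hx, rfl⟩ := hL hy
        exact hC' x (Or.inl hx)
      · rintro _ ⟨y, hy, rfl⟩
        refine hCU ?_
        have hyK := mem_img_iff.1 (hL hy)
        simp only [Subgroup.coe_mul, InvMemClass.coe_inv, Equiv.Perm.mul_apply]
        refine hC' _ (Or.inr ?_)
        rw [← hs.img_eq]
        exact apply_mem_img.2 hyK
  have := hN _ (inv_mem hT) _ hs'
  rwa [show h⁻¹ * (h * s * h⁻¹) * h⁻¹⁻¹ = s by group] at this

/-- A rectangle exchange moving some point moves some rectangle off itself. -/
theorem exists_rectangle_disjoint_img {M : Set (Fin d → ℝ)} {hM : IsMultirectangle M}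
    {n : recGroup M hM} (hn : n ≠ 1) : ∃ K, IsRectangle K ∧ K ⊆ M ∧
      ∀ x : M, (x : Fin d → ℝ) ∈ K → (n.1 x : Fin d → ℝ) ∉ K := by
  obtain ⟨x, hx⟩ : ∃ x, n.1 x ≠ x := by
    by_contra! h
    exact hn (Subtype.ext (Equiv.ext h))
  obtain ⟨P, hP, hPn⟩ := n.2
  obtain ⟨K, hK, hxK⟩ := hP.exists_mem x.2
  obtain ⟨v, hv⟩ := hPn K hK
  obtain ⟨a, b, hab, rfl⟩ := hP.2.1 K hK
  obtain ⟨j, hj⟩ : ∃ j, v j ≠ 0 := by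
    by_contra! h
    refine hx (Subtype.ext ?_)
    rw [hv x hxK, (funext h : v = 0), add_zero]
  rw [mem_box] at hxK
  have hmem : ∀ y, y ∈ Set.pi Set.univ (fun i => Set.Ico (x.1 i) (min (b i) (x.1 i + |v j|))) →
      y ∈ Set.pi Set.univ fun i => Set.Ico (a i) (b i) := fun y hy => by
    rw [mem_box] at hy
    exact mem_box.2 fun i => ⟨(hxK i).1.trans (hy i).1, (hy i).2.trans_le (min_le_left _ _)⟩
  refine ⟨_, ⟨x.1, fun i => min (b i) (x.1 i + |v j|), fun i => ?_, rfl⟩,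
    fun y hy => hP.subset hK (hmem y hy), fun y hy hy' => ?_⟩
  · exact lt_min (hxK i).2 (lt_add_of_pos_right _ (abs_pos.2 hj))
  · rw [hv y (hmem _ hy), mem_box] at hy'
    rw [mem_box] at hy
    have h1 := hy j
    have h2 := hy' j
    rw [Pi.add_apply] at h2
    have h3 := h1.2.trans_le (min_le_right _ _)
    have h4 := h2.2.trans_le (min_le_right _ _)
    rcases abs_cases (v j) with h | h <;> linarith [h1.1, h2.1]

/-- Every nontrivial subgroup normalized by the transposition group contains it. If `n` moves a
rectangle `K` off itself and `α`, `g` are supported in `K`, then `n α⁻¹ n⁻¹` commutes with `g` and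
`α`, so that the commutator of `n α⁻¹ n⁻¹ α` with `g` is that of `α` with `g`. -/
theorem transpositionGroup_le_of_normalized {M : Set (Fin d → ℝ)} (hM : IsMultirectangle M)
    (hd : 1 ≤ d) (N : Subgroup (recGroup M hM)) (hN : N ≠ ⊥)
    (hnorm : ∀ t ∈ transpositionGroup M hM, ∀ n ∈ N, t * n * t⁻¹ ∈ N) :
    transpositionGroup M hM ≤ N := by
  obtain ⟨n, hnN, hn⟩ := N.bot_or_exists_ne_one.resolve_left hN
  obtain ⟨K, hK, hKM, hnK⟩ := exists_rectangle_disjoint_img hn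
  refine transpositionGroup_le_of_transpositionsIn hM hd hK.isMultirectangle hK.nonempty hKM N
    hnorm ?_
  rintro τ ⟨P, Q, hτ, hPK, hQK⟩
  obtain ⟨α, hαT, g, hgT, hτeq, hfix⟩ := hτ.exists_commutator_eq hd
  have hα : ∀ x : M, (x : Fin d → ℝ) ∉ K → α⁻¹.1 x = x := fun x hx => by
    rw [InvMemClass.coe_inv, Equiv.Perm.inv_eq_iff_eq]
    exact (hfix x (fun h => hx (hPK h)) fun h => hx (hQK h)).1.symm
  have hcomm : ∀ γ : recGroup M hM, (∀ x : M, (x : Fin d → ℝ) ∉ P → (x : Fin d → ℝ) ∉ Q →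
      γ.1 x = x) → Commute (n * α⁻¹ * n⁻¹) γ := by
    refine fun γ hγ => Subtype.ext (Equiv.Perm.Disjoint.commute fun x => ?_)
    by_cases hx : (x : Fin d → ℝ) ∈ K
    · left
      rw [Subgroup.coe_mul, Subgroup.coe_mul, Equiv.Perm.mul_apply, Equiv.Perm.mul_apply, hα,
        InvMemClass.coe_inv, perm_apply_inv]
      intro h
      refine hnK _ h ?_
      rwa [InvMemClass.coe_inv, perm_apply_inv]
    · exact Or.inr (hγ x (fun h => hx (hPK h)) fun h => hx (hQK h))
  have h1 := hcomm α fun x hx hx' => (hfix x hx hx').1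
  have h2 := hcomm g fun x hx hx' => (hfix x hx hx').2
  set β := n * α⁻¹ * n⁻¹ with hβ
  have hm : β * α ∈ N := by
    have := N.mul_mem hnN (hnorm α⁻¹ (inv_mem hαT) n⁻¹ (inv_mem hnN))
    rwa [inv_inv, ← mul_assoc, ← mul_assoc] at this
  have hmg := N.mul_mem hm (hnorm g hgT _ (inv_mem hm))
  have e : β * α * (g * (β * α)⁻¹ * g⁻¹) = τ := by
    calc β * α * (g * (β * α)⁻¹ * g⁻¹) = β * (α * g * α⁻¹) * β⁻¹ * g⁻¹ := by group
      _ = α * g * α⁻¹ * β * β⁻¹ * g⁻¹ := by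
        rw [((h1.mul_right h2).mul_right h1.inv_right).eq]
      _ = τ := by rw [hτeq, mul_inv_cancel_right]
  exact e ▸ hmg

/-- A nonempty multirectangle admits a nontrivial product of rectangle transpositions. -/
theorem transpositionGroup_ne_bot {M : Set (Fin d → ℝ)} (hM : IsMultirectangle M) (hd : 1 ≤ d)
    (hne : M.Nonempty) : transpositionGroup M hM ≠ ⊥ := by
  obtain ⟨K, hKM, hK⟩ := hM.exists_rectangle_subset hne
  obtain ⟨H, u, hH, hHK, hHu, hHH, -⟩ := hK.exists_half hd
  obtain ⟨s, hsT, hs⟩ := exists_translation_swap_mem hM hH.isMultirectangle u (hHK.trans hKM)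
    (fun x hx => hKM (hHu x hx)) hHH
  obtain ⟨x, hx⟩ := hH.nonempty
  intro h
  rw [h, Subgroup.mem_bot] at hsT
  have := (hs ⟨x, hKM (hHK hx)⟩).1 hx
  rw [hsT] at this
  exact hHH x hx (this ▸ hx)

end RectExchange

open RectExchange
theorem mainTheorem2 {d : ℕ} (hd : 1 ≤ d) (M : Set (Fin d → ℝ)) (hM : IsMultirectangle M)
    (hne : M.Nonempty) :
    -- the derived subgroup is generated by the rectangle transpositions
    Subgroup.closure (transpositions M hM) = commutator (recGroup M hM) ∧
    -- it is generated by the small ones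
    (∃ ε₀ : ℝ, 0 < ε₀ ∧ ∀ ε : ℝ, 0 < ε → ε ≤ ε₀ →
      Subgroup.closure (smallTranspositions M hM ε) = commutator (recGroup M hM)) ∧
    -- it is normally generated (as a group in its own right) by the transpositions inside `U`
    (∀ U : Set (Fin d → ℝ), IsMultirectangle U → U.Nonempty → U ⊆ M →
      transpositionsIn M hM U ⊆ commutator (recGroup M hM) ∧
      Subgroup.normalClosure
        {g : commutator (recGroup M hM) | g.1 ∈ transpositionsIn M hM U} = ⊤) ∧
    -- every nontrivial subgroup normalized by the derived subgroup contains it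
    (∀ N : Subgroup (recGroup M hM), N ≠ ⊥ →
      (∀ g ∈ commutator (recGroup M hM), ∀ n ∈ N, g * n * g⁻¹ ∈ N) →
      commutator (recGroup M hM) ≤ N) ∧
    -- the derived subgroup is simple
    IsSimpleGroup (commutator (recGroup M hM)) ∧
    -- the derived subgroup lies in every nontrivial normal subgroup
    (∀ N : Subgroup (recGroup M hM), N.Normal → N ≠ ⊥ → commutator (recGroup M hM) ≤ N) := by
  have hT := transpositionGroup_eq_commutator hM hd hne
  have h4 : ∀ N : Subgroup (recGroup M hM), N ≠ ⊥ →
      (∀ g ∈ commutator (recGroup M hM), ∀ n ∈ N, g * n * g⁻¹ ∈ N) →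
      commutator (recGroup M hM) ≤ N := by
    rw [← hT]
    exact fun N hN hnorm => transpositionGroup_le_of_normalized hM hd N hN hnorm
  -- A normal subgroup of `D` is a subgroup of the whole group normalized by `D`.
  have hmap : ∀ N : Subgroup (commutator (recGroup M hM)), N.Normal →
      ∀ g ∈ commutator (recGroup M hM), ∀ n ∈ N.map (commutator (recGroup M hM)).subtype,
        g * n * g⁻¹ ∈ N.map (commutator (recGroup M hM)).subtype := by
    rintro N hN g hg _ ⟨n, hn, rfl⟩
    exact ⟨_, hN.conj_mem n hn ⟨g, hg⟩, rfl⟩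
  have htop : ∀ N : Subgroup (commutator (recGroup M hM)),
      commutator (recGroup M hM) ≤ N.map (commutator (recGroup M hM)).subtype → N = ⊤ := by
    refine fun N hN => (Subgroup.eq_top_iff' N).2 fun g => ?_
    obtain ⟨n, hn, e⟩ := hN g.2
    rwa [← (Subtype.ext e : n = g)]
  refine ⟨hT, ?_, fun U hU hUne hUM => ?_, h4, ?_, fun N hN hne' =>
    h4 N hne' fun g _ n hn => hN.conj_mem n hn g⟩
  · rw [← hT]
    exact exists_closure_smallTranspositions_eq hM hne
  · have hsub : transpositionsIn M hM U ⊆ commutator (recGroup M hM) := by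
      rw [← hT]
      exact fun τ ⟨P, Q, hτ, _⟩ => Subgroup.subset_closure ⟨P, Q, hτ⟩
    refine ⟨hsub, htop _ ?_⟩
    exact hT.ge.trans (transpositionGroup_le_of_transpositionsIn hM hd hU hUne hUM _
      (fun t ht => hmap _ Subgroup.normalClosure_normal t (hT.le ht))
      fun τ hτ => ⟨⟨τ, hsub hτ⟩, Subgroup.subset_normalClosure hτ, rfl⟩)
  · have : Nontrivial (commutator (recGroup M hM)) := by
      rw [← hT]
      exact (Subgroup.nontrivial_iff_ne_bot _).2 (transpositionGroup_ne_bot hM hd hne)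
    refine ⟨fun N hN => or_iff_not_imp_left.2 fun hbot => htop N (h4 _ ?_ (hmap N hN))⟩
    rwa [Ne, Subgroup.map_eq_bot_iff_of_injective _ (Subgroup.subtype_injective _)]
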